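/- For a (simple, undirected) graph $G=(V,E)$ let $B(G)$ be the universal unital C*-algebra generated by unitaries $u_x$, $x\in V$, subject to $u_x^2=1$ for all $x$, $u_xu_y=u_yu_x$ if $x$ and $y$ are not adjacent, and $u_xu_y=-u_yu_x$ if $x$ and $y$ are adjacent. A full matrix algebra is an algebra isomorphic to $M_n(\mathbb C)$ for some $n\ge 1$. A C*-algebra is AM (approximately matricial) if it is a C*-algebraic direct limit, over a nonempty directed index set and with unital connecting $*$-homomorphisms, of full matrix algebras. A C*-algebra is simple if it is nonzero and its only closed two-sided ideals are $0$ and itself. A trace on a unital C*-algebra $A$ is a tracial state, i.e. a positive linear functional $\tau$ on $A$ with $\tau(1)=1$ and $\tau(ab)=\tau(ba)$ for all $a,b\in A$. \textbf{Lemma.} For an infinite graph $G=(V,E)$ the following are equivalent. \begin{enumerate} \item The family of finite induced subgraphs $G_0$ of $G$ such that $B(G_0)$ is isomorphic to a full matrix algebra is cofinal in all finite induced subgraphs of $G$; that is, every finite $S\subseteq V$ is contained in a finite $T\subseteq V$ such that the algebra $B(G_0)$ of the subgraph $G_0$ of $G$ induced on $T$ is isomorphic to a full matrix algebra. \item $B(G)$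 is AM. \item $B(G)$ is simple and has a unique trace. \item For every finite nonempty $\mathbf s\subseteq V$ there is $v\in V$ such that the number of $u\in\mathbf s$ adjacent to $v$ is odd. \end{enumerate} -/

import Mathlib

noncomputable section

namespace GraphCStar

open UniformSpace

universe u v w

/-! ### Completion of a ring with a C*-seminorm -/

section Completion

variable (A : Type u) [SeminormedRing A] [NormedAlgebra ℂ A] [StarRing A] [StarModule ℂ A]
  (hstar : ∀ a : A, ‖star a‖ = ‖a‖) (hC : ∀ a : A, ‖a‖ * ‖a‖ ≤ ‖star a * a‖)

/-- The completion (after dividing by the null space of the seminorm) of a complex `*`-algebra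
with a submultiplicative seminorm satisfying the C*-identity, as a C*-algebra. The involution is
the continuous extension of the given one. -/
@[reducible] def completionCStarAlgebra : CStarAlgebra (Completion A) :=
  have huc : UniformContinuous (star : A → A) :=
    (AddMonoidHomClass.isometry_of_norm (starAddEquiv : A ≃+ A) hstar).uniformContinuous
  have hcoe (a : A) : Completion.map (star : A → A) (a : Completion A) = (star a : A) :=
    Completion.map_coe huc a
  have hcont : Continuous (Completion.map (star : A → A)) := Completion.continuous_map
  letI : StarRing (Completion A) :=
    { star := Completion.map star
      star_involutive := fun x => Completion.induction_on x
        (isClosed_eq (hcont.comp hcont) continuous_id) fun a => by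
          rw [hcoe, hcoe, star_star]
      star_mul := fun x y => Completion.induction_on₂ x y
        (isClosed_eq (hcont.comp continuous_mul)
          ((hcont.comp continuous_snd).mul (hcont.comp continuous_fst))) fun a b => by
          rw [← Completion.coe_mul, hcoe, hcoe, hcoe, star_mul, Completion.coe_mul]
      star_add := fun x y => Completion.induction_on₂ x y
        (isClosed_eq (hcont.comp continuous_add)
          ((hcont.comp continuous_fst).add (hcont.comp continuous_snd))) fun a b => by
          rw [← Completion.coe_add, hcoe, hcoe, hcoe, star_add, Completion.coe_add] }
  { (inferInstance : NormedRing (Completion A)),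
    (inferInstance : StarRing (Completion A)),
    (inferInstance : CompleteSpace (Completion A)),
    (inferInstance : Algebra ℂ (Completion A)) with
    norm_smul_le := norm_smul_le
    norm_mul_self_le := fun x => Completion.induction_on x
      (isClosed_le (continuous_norm.mul continuous_norm)
        (continuous_norm.comp (hcont.mul continuous_id))) fun a => by
        change _ ≤ ‖Completion.map star (a : Completion A) * a‖
        rw [hcoe, ← Completion.coe_mul, Completion.norm_coe, Completion.norm_coe]
        exact hC a
    star_smul := fun c x => Completion.induction_on x
      (isClosed_eq (hcont.comp (continuous_const_smul c)) (hcont.const_smul (star c))) fun a => by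
        change Completion.map star (c • (a : Completion A)) =
          star c • Completion.map star (a : Completion A)
        rw [← Completion.coe_smul, hcoe, hcoe, star_smul, Completion.coe_smul] }

end Completion

/-! ### The free complex `*`-algebra on self-adjoint generators -/

/-- The free complex `*`-algebra on self-adjoint generators indexed by `V`: noncommutative
polynomials, where `*` reverses words and conjugates coefficients. -/
def FreeStarAlgebra (V : Type u) : Type u := MonoidAlgebra ℂ (FreeMonoid V)

namespace FreeStarAlgebra

variable {V : Type u}

instance : Ring (FreeStarAlgebra V) := inferInstanceAs (Ring (MonoidAlgebra ℂ (FreeMonoid V)))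

instance : Algebra ℂ (FreeStarAlgebra V) :=
  inferInstanceAs (Algebra ℂ (MonoidAlgebra ℂ (FreeMonoid V)))

/-- The monomial `c • m`. -/
def mono (m : FreeMonoid V) (c : ℂ) : FreeStarAlgebra V := MonoidAlgebra.single m c

/-- The generator attached to `x`. -/
def gen (x : V) : FreeStarAlgebra V := mono (FreeMonoid.of x) 1

theorem one_def : (1 : FreeStarAlgebra V) = mono 1 1 := rfl

theorem mono_mul_mono (m n : FreeMonoid V) (c d : ℂ) :
    mono m c * mono n d = mono (m * n) (c * d) := MonoidAlgebra.single_mul_single ..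

theorem smul_mono (m : FreeMonoid V) (c d : ℂ) : c • mono m d = mono m (c * d) :=
  MonoidAlgebra.smul_single ..

theorem induction_linear {motive : FreeStarAlgebra V → Prop} (x : FreeStarAlgebra V)
    (zero : motive 0) (add : ∀ x y, motive x → motive y → motive (x + y))
    (mono : ∀ m c, motive (mono m c)) : motive x :=
  MonoidAlgebra.induction_linear (motive := motive) x zero (fun x y => add x y) mono

/-- The involution of the free `*`-algebra as an additive map. -/
def starHom : FreeStarAlgebra V →+ FreeStarAlgebra V :=
  (Finsupp.liftAddHom fun m : FreeMonoid V =>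
    ((MonoidAlgebra.singleAddHom (star m)).comp (starAddEquiv : ℂ ≃+ ℂ).toAddMonoidHom :
      ℂ →+ MonoidAlgebra ℂ (FreeMonoid V))).comp MonoidAlgebra.coeffAddEquiv.toAddMonoidHom

theorem starHom_mono (m : FreeMonoid V) (c : ℂ) :
    starHom (mono m c) = mono (star m) (star c) := by
  refine (Finsupp.liftAddHom_apply_single _ m c).trans ?_
  rfl

instance : StarRing (FreeStarAlgebra V) where
  star := starHom
  star_involutive x := by
    induction x using induction_linear with
    | zero => simp
    | add x y hx hy => rw [map_add, map_add, hx, hy]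
    | mono m c => rw [starHom_mono, starHom_mono, star_star, star_star]
  star_mul x y := by
    change starHom (x * y) = starHom y * starHom x
    induction x using induction_linear with
    | zero => simp
    | add x x' hx hx' => rw [add_mul, map_add, map_add, mul_add, hx, hx']
    | mono m c =>
      induction y using induction_linear with
      | zero => simp
      | add y y' hy hy' => rw [mul_add, map_add, map_add, add_mul, hy, hy']
      | mono n d =>
        rw [mono_mul_mono, starHom_mono, starHom_mono, starHom_mono, mono_mul_mono, star_mul,
          star_mul]
  star_add x y := map_add starHom x y

theorem star_mono (m : FreeMonoid V) (c : ℂ) : star (mono m c) = mono (star m) (star c) :=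
  starHom_mono m c

instance : StarModule ℂ (FreeStarAlgebra V) where
  star_smul c x := by
    induction x using induction_linear with
    | zero => simp
    | add x y hx hy => rw [smul_add, star_add, star_add, smul_add, hx, hy]
    | mono m d => rw [smul_mono, star_mono, star_mono, smul_mono, star_mul']

theorem star_gen (x : V) : star (gen x) = gen x := by
  rw [gen, star_mono, FreeMonoid.star_of, _root_.star_one]

end FreeStarAlgebra

/-! ### The C*-algebra of a graph -/

section GraphAlgebra

variable {V : Type u}

/-- The defining relations: a family of self-adjoint unitaries (unitaries of square `1`) such that
nonadjacent vertices give commuting, and adjacent vertices give anticommuting unitaries. -/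
structure SatisfiesRelations (G : SimpleGraph V) {A : Type v} [CStarAlgebra A] (a : V → A) :
    Prop where
  unitary : ∀ x, a x ∈ unitary A
  sq : ∀ x, a x ^ 2 = 1
  commute : ∀ x y, ¬ G.Adj x y → a x * a y = a y * a x
  anticommute : ∀ x y, G.Adj x y → a x * a y = -(a y * a x)

/-- C*-seminorms on the free `*`-algebra that vanish on the defining relations of `B(G)`. -/
structure IsAdmissible (G : SimpleGraph V) (p : Seminorm ℂ (FreeStarAlgebra V)) : Prop where
  mul_le : ∀ a b, p (a * b) ≤ p a * p b
  star_mul_self : ∀ a, p (star a * a) = p a * p a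
  sq : ∀ x, p (.gen x * .gen x - 1) = 0
  commute : ∀ x y, ¬ G.Adj x y → p (.gen x * .gen y - .gen y * .gen x) = 0
  anticommute : ∀ x y, G.Adj x y → p (.gen x * .gen y + .gen y * .gen x) = 0

variable {G : SimpleGraph V} {p : Seminorm ℂ (FreeStarAlgebra V)}

open FreeStarAlgebra

theorem IsAdmissible.zero (G : SimpleGraph V) : IsAdmissible G 0 := by
  constructor <;> simp

theorem IsAdmissible.one_le (hp : IsAdmissible G p) : p 1 ≤ 1 := by
  have h := hp.star_mul_self 1
  rw [_root_.star_one, mul_one] at h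
  nlinarith [apply_nonneg p (1 : FreeStarAlgebra V)]

theorem IsAdmissible.gen_le (hp : IsAdmissible G p) (x : V) : p (gen x) ≤ 1 := by
  have h := hp.star_mul_self (gen x)
  rw [star_gen] at h
  have h2 := map_add_le_add p (gen x * gen x - 1) 1
  rw [sub_add_cancel, hp.sq x] at h2
  nlinarith [apply_nonneg p (gen x), hp.one_le]

theorem IsAdmissible.mono_one_le (hp : IsAdmissible G p) (m : FreeMonoid V) :
    p (mono m 1) ≤ 1 := by
  induction m using FreeMonoid.recOn with
  | one => exact hp.one_le
  | of_mul x m h =>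
    have : mono (FreeMonoid.of x * m) 1 = gen x * mono m 1 := by
      rw [gen, mono_mul_mono, one_mul]
    rw [this]
    exact (hp.mul_le _ _).trans (mul_le_one₀ (hp.gen_le x) (apply_nonneg p _) h)

theorem bounded_admissible (G : SimpleGraph V) (a : FreeStarAlgebra V) :
    ∃ C : ℝ, ∀ p : Seminorm ℂ (FreeStarAlgebra V), IsAdmissible G p → p a ≤ C := by
  induction a using FreeStarAlgebra.induction_linear with
  | zero => exact ⟨0, fun p _ => by simp⟩
  | add x y hx hy =>
    obtain ⟨C, hC⟩ := hx
    obtain ⟨D, hD⟩ := hy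
    exact ⟨C + D, fun p hp => (map_add_le_add p x y).trans (add_le_add (hC p hp) (hD p hp))⟩
  | mono m c =>
    refine ⟨‖c‖, fun p hp => ?_⟩
    have : mono m c = c • mono m 1 := by rw [smul_mono, mul_one]
    rw [this, map_smul_eq_mul]
    exact mul_le_of_le_one_right (norm_nonneg c) (hp.mono_one_le m)

/-- The largest C*-seminorm on the free `*`-algebra that vanishes on the relations of `B(G)`. -/
def maxNorm (G : SimpleGraph V) (a : FreeStarAlgebra V) : ℝ :=
  ⨆ p : {p : Seminorm ℂ (FreeStarAlgebra V) // IsAdmissible G p}, p.1 a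

instance (G : SimpleGraph V) :
    Nonempty {p : Seminorm ℂ (FreeStarAlgebra V) // IsAdmissible G p} := ⟨⟨0, .zero G⟩⟩

theorem le_maxNorm (hp : IsAdmissible G p) (a : FreeStarAlgebra V) : p a ≤ maxNorm G a := by
  obtain ⟨C, hC⟩ := bounded_admissible G a
  exact le_ciSup (f := fun p : {p : Seminorm ℂ (FreeStarAlgebra V) // IsAdmissible G p} => p.1 a)
    ⟨C, by rintro _ ⟨q, rfl⟩; exact hC q.1 q.2⟩ ⟨p, hp⟩

theorem maxNorm_le {a : FreeStarAlgebra V} {C : ℝ}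
    (h : ∀ p : Seminorm ℂ (FreeStarAlgebra V), IsAdmissible G p → p a ≤ C) : maxNorm G a ≤ C :=
  ciSup_le fun q => h q.1 q.2

theorem maxNorm_nonneg (G : SimpleGraph V) (a : FreeStarAlgebra V) : 0 ≤ maxNorm G a :=
  le_maxNorm (.zero G) a

/-- `maxNorm` as a seminorm. -/
def maxSeminorm (G : SimpleGraph V) : Seminorm ℂ (FreeStarAlgebra V) :=
  Seminorm.ofSMulLE (maxNorm G)
    (le_antisymm (maxNorm_le fun p _ => (map_zero p).le) (maxNorm_nonneg G 0))
    (fun a b => maxNorm_le fun p hp => (map_add_le_add p a b).trans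
      (add_le_add (le_maxNorm hp a) (le_maxNorm hp b)))
    (fun c a => maxNorm_le fun p hp => by
      rw [map_smul_eq_mul]
      exact mul_le_mul_of_nonneg_left (le_maxNorm hp a) (norm_nonneg c))

theorem maxSeminorm_apply (G : SimpleGraph V) (a : FreeStarAlgebra V) :
    maxSeminorm G a = maxNorm G a := rfl

theorem isAdmissible_maxSeminorm (G : SimpleGraph V) : IsAdmissible G (maxSeminorm G) where
  mul_le a b := maxNorm_le fun p hp => (hp.mul_le a b).trans
    (mul_le_mul (le_maxNorm hp a) (le_maxNorm hp b) (apply_nonneg p b) (maxNorm_nonneg G a))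
  star_mul_self a := by
    refine le_antisymm (maxNorm_le fun p hp => ?_) ?_
    · rw [hp.star_mul_self]
      exact mul_self_le_mul_self (apply_nonneg p a) (le_maxNorm hp a)
    · have : maxNorm G a ≤ √(maxNorm G (star a * a)) := maxNorm_le fun p hp => by
        refine Real.le_sqrt_of_sq_le ?_
        rw [sq, ← hp.star_mul_self]
        exact le_maxNorm hp _
      calc _ ≤ √(maxNorm G (star a * a)) * √(maxNorm G (star a * a)) :=
            mul_self_le_mul_self (maxNorm_nonneg G a) this
        _ = _ := Real.mul_self_sqrt (maxNorm_nonneg G _)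
  sq x := le_antisymm (maxNorm_le fun p hp => (hp.sq x).le) (maxNorm_nonneg G _)
  commute x y h := le_antisymm (maxNorm_le fun p hp => (hp.commute x y h).le) (maxNorm_nonneg G _)
  anticommute x y h :=
    le_antisymm (maxNorm_le fun p hp => (hp.anticommute x y h).le) (maxNorm_nonneg G _)

theorem IsAdmissible.le_star (hp : IsAdmissible G p) (a : FreeStarAlgebra V) :
    p a ≤ p (star a) := by
  rcases (apply_nonneg p a).eq_or_lt with h | h
  · rw [← h]; exact apply_nonneg p _
  · exact le_of_mul_le_mul_right ((hp.star_mul_self a).symm.trans_le (hp.mul_le _ _)) h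

theorem IsAdmissible.star_eq (hp : IsAdmissible G p) (a : FreeStarAlgebra V) :
    p (star a) = p a :=
  le_antisymm (by simpa using hp.le_star (star a)) (hp.le_star a)

/-- The free `*`-algebra, equipped with the largest C*-seminorm vanishing on the relations. -/
def PreAlgebra (_G : SimpleGraph V) : Type u := FreeStarAlgebra V

namespace PreAlgebra

variable (G : SimpleGraph V)

instance : SeminormedRing (PreAlgebra G) :=
  RingSeminorm.toSeminormedRing (R := FreeStarAlgebra V)
    { (maxSeminorm G).toAddGroupSeminorm with mul_le' := (isAdmissible_maxSeminorm G).mul_le }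

theorem norm_def (a : PreAlgebra G) : ‖a‖ = maxSeminorm G a := rfl

instance : NormedAlgebra ℂ (PreAlgebra G) :=
  { (inferInstance : Algebra ℂ (FreeStarAlgebra V)) with
    norm_smul_le := fun c a => (map_smul_eq_mul (maxSeminorm G) c a).le }

instance : StarRing (PreAlgebra G) := inferInstanceAs (StarRing (FreeStarAlgebra V))

instance : StarModule ℂ (PreAlgebra G) where
  star_smul c a := star_smul c (show FreeStarAlgebra V from a)

end PreAlgebra

/-- The universal C*-algebra `B(G)` generated by unitaries subject to the defining relations. -/
def B (G : SimpleGraph V) : Type u := Completion (PreAlgebra G)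

instance (G : SimpleGraph V) : CStarAlgebra (B G) :=
  completionCStarAlgebra (PreAlgebra G) (isAdmissible_maxSeminorm G).star_eq
    fun a => ((isAdmissible_maxSeminorm G).star_mul_self a).ge

namespace B

variable (G : SimpleGraph V)

/-- The canonical map from the free `*`-algebra to `B(G)`. -/
def ofFree : FreeStarAlgebra V →⋆ₐ[ℂ] B G where
  toFun a := Completion.coe' (α := PreAlgebra G) a
  map_one' := rfl
  map_mul' := fun a b => Completion.coe_mul (α := PreAlgebra G) a b
  map_zero' := rfl
  map_add' := fun a b => Completion.coe_add (α := PreAlgebra G) a b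
  commutes' _ := rfl
  map_star' a := (Completion.map_coe (AddMonoidHomClass.isometry_of_norm
    (starAddEquiv : PreAlgebra G ≃+ PreAlgebra G)
    (isAdmissible_maxSeminorm G).star_eq).uniformContinuous a).symm

theorem norm_ofFree (a : FreeStarAlgebra V) : ‖ofFree G a‖ = maxSeminorm G a :=
  Completion.norm_coe (E := PreAlgebra G) a

theorem denseRange_ofFree : DenseRange (ofFree G) :=
  Completion.denseRange_coe (α := PreAlgebra G)

/-- The generating unitaries `u_x` of `B(G)`. -/
def gen (x : V) : B G := ofFree G (.gen x)

theorem satisfiesRelations_gen : SatisfiesRelations G (gen G) := by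
  have key (a : FreeStarAlgebra V) (h : maxSeminorm G a = 0) : ofFree G a = 0 := by
    rw [← norm_eq_zero, norm_ofFree, h]
  have hs (x : V) : star (gen G x) = gen G x := by rw [gen, ← map_star, star_gen]
  have hsq (x : V) : gen G x * gen G x = 1 := by
    have := key _ ((isAdmissible_maxSeminorm G).sq x)
    rwa [map_sub, map_mul, map_one, sub_eq_zero] at this
  refine ⟨fun x => ?_, fun x => by rw [pow_two, hsq], fun x y h => ?_, fun x y h => ?_⟩
  · rw [Unitary.mem_iff, hs, hsq]; exact ⟨rfl, rfl⟩
  · have := key _ ((isAdmissible_maxSeminorm G).commute x y h)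
    rwa [map_sub, map_mul, map_mul, sub_eq_zero] at this
  · have := key _ ((isAdmissible_maxSeminorm G).anticommute x y h)
    rwa [map_add, map_mul, map_mul, add_eq_zero_iff_eq_neg] at this

/-- The homomorphism of the free algebra determined by the images of the generators. -/
def freeLiftAlg {A : Type v} [CStarAlgebra A] (a : V → A) : FreeStarAlgebra V →ₐ[ℂ] A :=
  MonoidAlgebra.lift ℂ A (FreeMonoid V) (FreeMonoid.lift a)

theorem freeLiftAlg_mono {A : Type v} [CStarAlgebra A] (a : V → A) (m : FreeMonoid V) (c : ℂ) :
    freeLiftAlg a (mono m c) = c • FreeMonoid.lift a m :=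
  MonoidAlgebra.lift_single (FreeMonoid.lift a) m c

/-- The `*`-homomorphism of the free `*`-algebra determined by self-adjoint elements. -/
def freeLift {A : Type v} [CStarAlgebra A] (a : V → A) (ha : ∀ x, star (a x) = a x) :
    FreeStarAlgebra V →⋆ₐ[ℂ] A :=
  { freeLiftAlg a with
    map_star' := fun f => by
      have hw (m : FreeMonoid V) : FreeMonoid.lift a (star m) = star (FreeMonoid.lift a m) := by
        induction m using FreeMonoid.recOn with
        | one => simp
        | of_mul x m h => simp [h, ha]
      change freeLiftAlg a (star f) = star (freeLiftAlg a f)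
      induction f using FreeStarAlgebra.induction_linear with
      | zero => simp
      | add f g hf hg => rw [star_add, map_add, map_add, star_add, hf, hg]
      | mono m c => rw [star_mono, freeLiftAlg_mono, freeLiftAlg_mono, hw, star_smul] }

theorem freeLift_gen {A : Type v} [CStarAlgebra A] (a : V → A) (ha : ∀ x, star (a x) = a x)
    (x : V) : freeLift a ha (.gen x) = a x :=
  (freeLiftAlg_mono a (FreeMonoid.of x) 1).trans (by simp)

theorem free_hom_ext {A : Type v} [CStarAlgebra A] {f g : FreeStarAlgebra V →⋆ₐ[ℂ] A}
    (h : ∀ x, f (.gen x) = g (.gen x)) (a : FreeStarAlgebra V) : f a = g a := by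
  induction a using FreeStarAlgebra.induction_linear with
  | zero => simp
  | add a b ha hb => rw [map_add, map_add, ha, hb]
  | mono m c =>
    have : mono m c = c • mono m 1 := by rw [smul_mono, mul_one]
    rw [this, map_smul, map_smul]
    congr 1
    induction m using FreeMonoid.recOn with
    | one => rw [← one_def, map_one, map_one]
    | of_mul x m ih =>
      have e : mono (FreeMonoid.of x * m) 1 = FreeStarAlgebra.gen x * mono m 1 := by
        rw [FreeStarAlgebra.gen, mono_mul_mono, one_mul]
      rw [e, map_mul, map_mul, h, ih (by rw [smul_mono, mul_one])]

/-- The universal property of `B(G)`: a family in a unital C*-algebra satisfying the defining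
relations is the image of the generators under exactly one unital `*`-homomorphism. -/
theorem existsUnique_lift {A : Type v} [CStarAlgebra A] (a : V → A)
    (ha : SatisfiesRelations G a) : ∃! φ : B G →⋆ₐ[ℂ] A, ∀ x, φ (gen G x) = a x := by
  have hs (x : V) : star (a x) = a x := by
    have h1 := (Unitary.mem_iff.mp (ha.unitary x)).1
    have h2 := ha.sq x
    calc star (a x) = star (a x) * a x ^ 2 := by rw [h2, mul_one]
      _ = a x := by rw [pow_two, ← mul_assoc, h1, one_mul]
  set F := freeLift a hs with hF
  let p : Seminorm ℂ (FreeStarAlgebra V) :=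
    Seminorm.of (fun f => ‖F f‖) (fun f g => by rw [map_add]; exact norm_add_le _ _)
      (fun c f => by rw [map_smul]; exact norm_smul _ _)
  have hp : IsAdmissible G p :=
    { mul_le := fun f g => by
        change ‖F (f * g)‖ ≤ ‖F f‖ * ‖F g‖
        rw [map_mul]; exact norm_mul_le _ _
      star_mul_self := fun f => by
        change ‖F (star f * f)‖ = ‖F f‖ * ‖F f‖
        rw [map_mul, map_star, CStarRing.norm_star_mul_self]
      sq := fun x => by
        change ‖F _‖ = 0
        rw [map_sub, map_mul, map_one, hF, freeLift_gen, ← pow_two, ha.sq, sub_self, norm_zero]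
      commute := fun x y h => by
        change ‖F _‖ = 0
        rw [map_sub, map_mul, map_mul, hF, freeLift_gen, freeLift_gen, ha.commute x y h, sub_self,
          norm_zero]
      anticommute := fun x y h => by
        change ‖F _‖ = 0
        rw [map_add, map_mul, map_mul, hF, freeLift_gen, freeLift_gen, ha.anticommute x y h,
          neg_add_cancel, norm_zero] }
  have hle (f : FreeStarAlgebra V) : ‖F f‖ ≤ ‖ofFree G f‖ := by
    rw [norm_ofFree]; exact le_maxNorm hp f
  have huc : UniformContinuous (fun f : PreAlgebra G => F f) := by
    let F' : PreAlgebra G →+ A := (F : FreeStarAlgebra V →+ A)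
    exact (AddMonoidHomClass.lipschitz_of_bound F' 1 fun f => by
      rw [one_mul]; exact le_maxNorm hp f).uniformContinuous
  let E : B G → A := Completion.extension (fun f : PreAlgebra G => F f)
  have hE (f : FreeStarAlgebra V) : E (ofFree G f) = F f := Completion.extension_coe huc f
  have hEc : Continuous E := Completion.continuous_extension
  have hd := denseRange_ofFree G
  let Φ : B G →⋆ₐ[ℂ] A :=
    { toFun := E
      map_one' := by rw [← map_one (ofFree G), hE, map_one]
      map_mul' := fun x y => hd.induction_on₂
        (isClosed_eq (hEc.comp continuous_mul) ((hEc.comp continuous_fst).mul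
          (hEc.comp continuous_snd))) (fun f g => by rw [← map_mul, hE, hE, hE, map_mul]) x y
      map_zero' := by rw [← map_zero (ofFree G), hE, map_zero]
      map_add' := fun x y => hd.induction_on₂
        (isClosed_eq (hEc.comp continuous_add) ((hEc.comp continuous_fst).add
          (hEc.comp continuous_snd))) (fun f g => by rw [← map_add, hE, hE, hE, map_add]) x y
      commutes' := fun c => by
        rw [← AlgHomClass.commutes (ofFree G) c, hE, AlgHomClass.commutes]
      map_star' := fun x => hd.induction_on x
        (isClosed_eq (hEc.comp continuous_star) hEc.star)
        (fun f => by rw [← map_star, hE, hE, map_star]) }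
  refine ⟨Φ, fun x => (hE _).trans (freeLift_gen a hs x), fun Ψ hΨ => ?_⟩
  have hΨc : Continuous Ψ := AddMonoidHomClass.continuous_of_bound Ψ 1 fun x => by
    rw [one_mul]; exact NonUnitalStarAlgHom.norm_apply_le Ψ x
  refine DFunLike.coe_injective (hd.equalizer hΨc hEc (funext fun f => ?_))
  refine (free_hom_ext (f := Ψ.comp (ofFree G)) (g := F) (fun x => ?_) f).trans (hE f).symm
  exact (hΨ x).trans (freeLift_gen a hs x).symm

end B

end GraphAlgebra

/-! ### Full matrix algebras, direct limits, simplicity and traces -/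

/-- `A` is a full matrix algebra: it is `*`-isomorphic to `M_n(ℂ)` for some `n ≥ 1`. -/
def IsFullMatrixAlgebra (A : Type v) [CStarAlgebra A] : Prop :=
  ∃ n : ℕ, 1 ≤ n ∧ Nonempty (A ≃⋆ₐ[ℂ] Matrix (Fin n) (Fin n) ℂ)

/-- `A`, with the maps `ι i : D i → A`, is the (C*-algebraic) direct limit of the system
`(D i, f i j)` of unital C*-algebras and unital `*`-homomorphisms: the `ι i` are compatible with
the system, their ranges have dense union, and the norm of `ι i a` is the limit of `‖f i j a‖`
along `j ≥ i`. Equivalently, `A` is the completion of the algebraic direct limit. -/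
structure IsDirectLimit {I : Type w} [Preorder I] (D : I → Type w) [∀ i, CStarAlgebra (D i)]
    (f : ∀ i j, i ≤ j → (D i →⋆ₐ[ℂ] D j)) (A : Type v) [CStarAlgebra A]
    (ι : ∀ i, D i →⋆ₐ[ℂ] A) : Prop where
  map_self : ∀ i (a : D i), f i i le_rfl a = a
  map_map : ∀ i j k (hij : i ≤ j) (hjk : j ≤ k) (a : D i),
    f j k hjk (f i j hij a) = f i k (hij.trans hjk) a
  compatible : ∀ i j (hij : i ≤ j) (a : D i), ι j (f i j hij a) = ι i a
  dense : Dense (⋃ i, Set.range (ι i))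
  norm_eq : ∀ i (a : D i), Filter.Tendsto (fun j : Set.Ici i => ‖f i j j.2 a‖) Filter.atTop
    (nhds ‖ι i a‖)

/-- `A` is AM (approximately matricial): it is a direct limit of full matrix algebras, over some
nonempty directed set and with unital connecting maps. -/
def IsAM (A : Type v) [CStarAlgebra A] : Prop :=
  ∃ (I : Type v) (_ : Preorder I) (_ : IsDirectedOrder I) (_ : Nonempty I) (D : I → Type v)
    (_ : ∀ i, CStarAlgebra (D i)) (f : ∀ i j, i ≤ j → (D i →⋆ₐ[ℂ] D j))
    (ι : ∀ i, D i →⋆ₐ[ℂ] A),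
    (∀ i, IsFullMatrixAlgebra (D i)) ∧ IsDirectLimit D f A ι

/-- A C*-algebra is simple if it is nonzero and has no closed two-sided ideals other than `0` and
itself. -/
def IsSimpleCStarAlgebra (A : Type v) [CStarAlgebra A] : Prop :=
  Nontrivial A ∧ ∀ J : TwoSidedIdeal A, IsClosed (J : Set A) → J = ⊥ ∨ J = ⊤

/-- A trace on a unital C*-algebra: a tracial state, that is, a positive linear functional of value
`1` at the unit with `τ (a * b) = τ (b * a)`. -/
structure IsTrace {A : Type v} [CStarAlgebra A] (τ : A →ₗ[ℂ] ℂ) : Prop where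
  nonneg : ∀ a, 0 ≤ (τ (star a * a)).re ∧ (τ (star a * a)).im = 0
  map_one : τ 1 = 1
  map_mul_comm : ∀ a b, τ (a * b) = τ (b * a)

end GraphCStar

end

noncomputable section

namespace GraphCStar

open FreeStarAlgebra

/-! Up to sign, a product of generators depends only on its content, the vector in the `ZMod
2`-space of finite subsets of `V` that counts letters modulo 2. Conjugating a word by `u_v`
multiplies it by the sign of the number of letters adjacent to `v`. Adjacency is thus a symmetric
bilinear form on contents, and condition 4 says that it is nondegenerate. The algebra `B G` is a
twisted group algebra of the contents, represented on the square summable functions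
(`canonicalRep`). The vacuum vector state is a trace that vanishes on all words of nonzero content.
The representation is isometric and the trace faithful (`norm_canonicalRep`,
`canonicalTrace_faithful`).

If the form is nondegenerate, every word of nonzero content is negated by conjugation with some
generator. Hence every trace kills it (`IsNondegenerate.trace_eq`). Averaging over such conjugations
pushes any element of a closed ideal towards its trace times the unit, so a proper closed ideal has
trace zero and is zero by faithfulness (`IsNondegenerate.isSimple`). If the form is degenerate, a
content in its radical gives a central word, and weighting the trace by one plus a multiple of that
word yields a second trace (`isNondegenerate_of_trace_unique`). Thus uniqueness of the trace alone
forces nondegeneracy. An AM algebra has at most one trace, because a full matrix algebra has only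
one.

For cofinality, a finite vertex set is enlarged one vertex at a time, each time shrinking the
radical of the restricted form (`IsNondegenerate.exists_finset`). A finite nondegenerate graph has a
finite-dimensional simple algebra, which is a full matrix algebra by Wedderburn's theorem and a
unitarization argument. Conversely, `B G` is the direct limit of the algebras of a cofinal family of
finite induced subgraphs. -/

/-! ### Words and their contents -/

/-- The character of `ZMod 2` with values `±1`. -/
def sgn (c : ZMod 2) : ℂ := if c = 0 then 1 else -1

theorem ZMod.two_cases (c : ZMod 2) : c = 0 ∨ c = 1 := by
  revert c; decide

@[simp] theorem sgn_zero : sgn 0 = 1 := by simp [sgn]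

@[simp] theorem sgn_one : sgn 1 = -1 := by simp [sgn]

theorem sgn_add (c d : ZMod 2) : sgn (c + d) = sgn c * sgn d := by
  rcases ZMod.two_cases c with rfl | rfl <;> rcases ZMod.two_cases d with rfl | rfl <;>
    simp [show (1 + 1 : ZMod 2) = 0 from rfl]

theorem sgn_mul_self (c : ZMod 2) : sgn c * sgn c = 1 := by
  rw [← sgn_add, CharTwo.add_self_eq_zero, sgn_zero]

theorem norm_sgn (c : ZMod 2) : ‖sgn c‖ = 1 := by
  rcases ZMod.two_cases c with rfl | rfl <;> simp

section Content

variable {V : Type u}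

/-- The multiset of letters of a word, counted modulo `2`. -/
def content (l : List V) : V →₀ ZMod 2 := (l.map fun x => Finsupp.single x 1).sum

@[simp] theorem content_nil : content ([] : List V) = 0 := rfl

@[simp] theorem content_cons (x : V) (l : List V) :
    content (x :: l) = Finsupp.single x 1 + content l := rfl

@[simp] theorem content_append (l m : List V) : content (l ++ m) = content l + content m := by
  simp [content]

@[simp] theorem content_reverse (l : List V) : content l.reverse = content l := by
  induction l with
  | nil => rfl
  | cons x l ih => simp [ih, add_comm]

theorem content_map {W : Type v} (f : V → W) (l : List V) :
    content (l.map f) = (content l).mapDomain f := by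
  induction l with
  | nil => simp
  | cons x l ih => simp [ih, Finsupp.mapDomain_add, Finsupp.mapDomain_single]

theorem finsupp_add_self (s : V →₀ ZMod 2) : s + s = 0 := by
  ext; exact CharTwo.add_self_eq_zero _

theorem content_apply_of_notMem {x : V} {l : List V} (h : x ∉ l) : content l x = 0 := by
  induction l with
  | nil => simp
  | cons y l ih =>
    rw [List.mem_cons, not_or] at h
    simp [ih h.2, Ne.symm h.1]

theorem content_surjective : Function.Surjective (content : List V → V →₀ ZMod 2) := by
  intro s
  induction s using Finsupp.induction_linear with
  | zero => exact ⟨[], rfl⟩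
  | add s t hs ht =>
    obtain ⟨l, rfl⟩ := hs
    obtain ⟨m, rfl⟩ := ht
    exact ⟨l ++ m, content_append l m⟩
  | single x c =>
    rcases ZMod.two_cases c with rfl | rfl
    · exact ⟨[], by simp⟩
    · exact ⟨[x], by simp⟩

/-- A word of given content. -/
def wordOf (s : V →₀ ZMod 2) : List V := (content_surjective s).choose

@[simp] theorem content_wordOf (s : V →₀ ZMod 2) : content (wordOf s) = s :=
  (content_surjective s).choose_spec

open Classical in
/-- The number modulo `2` of elements of `s` adjacent to `v`. -/
def adjForm (G : SimpleGraph V) (v : V) : (V →₀ ZMod 2) →+ ZMod 2 :=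
  Finsupp.liftAddHom fun y => if G.Adj v y then AddMonoidHom.id _ else 0

open Classical in
theorem adjForm_single (G : SimpleGraph V) (v y : V) :
    adjForm G v (Finsupp.single y 1) = if G.Adj v y then 1 else 0 := by
  rw [adjForm, Finsupp.liftAddHom_apply_single]
  split_ifs <;> rfl

/-- No nonzero content is adjacent an even number of times to every vertex. -/
def IsNondegenerate (G : SimpleGraph V) : Prop :=
  ∀ s : V →₀ ZMod 2, s ≠ 0 → ∃ v, adjForm G v s = 1

end Content

/-! ### Words in generators satisfying the relations -/

section Relations

variable {V : Type u} {G : SimpleGraph V} {A : Type v} [CStarAlgebra A] {a : V → A}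

/-- The product of the letters of a word. -/
def wordProd (a : V → A) (l : List V) : A := (l.map a).prod

@[simp] theorem wordProd_nil (a : V → A) : wordProd a [] = 1 := rfl

@[simp] theorem wordProd_cons (a : V → A) (x : V) (l : List V) :
    wordProd a (x :: l) = a x * wordProd a l := by simp [wordProd]

@[simp] theorem wordProd_append (a : V → A) (l m : List V) :
    wordProd a (l ++ m) = wordProd a l * wordProd a m := by simp [wordProd]

theorem map_wordProd {A' : Type w} [CStarAlgebra A'] (φ : A →⋆ₐ[ℂ] A') (l : List V) :
    φ (wordProd a l) = wordProd (fun x => φ (a x)) l := by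
  induction l with
  | nil => simp
  | cons x l ih => simp [ih]

theorem wordProd_map {W : Type w} (f : W → V) (l : List W) :
    wordProd a (l.map f) = wordProd (fun x => a (f x)) l := by
  simp [wordProd, Function.comp_def]

namespace SatisfiesRelations

theorem mul_self (h : SatisfiesRelations G a) (x : V) : a x * a x = 1 := by
  rw [← pow_two, h.sq]

theorem star_eq (h : SatisfiesRelations G a) (x : V) : star (a x) = a x := by
  calc star (a x) = star (a x) * (a x * a x) := by rw [h.mul_self, mul_one]
    _ = a x := by rw [← mul_assoc, (Unitary.mem_iff.mp (h.unitary x)).1, one_mul]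

theorem map {A' : Type w} [CStarAlgebra A'] (φ : A →⋆ₐ[ℂ] A') (h : SatisfiesRelations G a) :
    SatisfiesRelations G fun x => φ (a x) where
  unitary x := by
    rw [Unitary.mem_iff, ← map_star, ← map_mul, ← map_mul, h.star_eq, h.mul_self, map_one]
    exact ⟨rfl, rfl⟩
  sq x := by rw [← map_pow, h.sq, map_one]
  commute x y hxy := by rw [← map_mul, h.commute x y hxy, map_mul]
  anticommute x y hxy := by rw [← map_mul, h.anticommute x y hxy, map_neg, map_mul]

theorem comap {W : Type w} (f : W → V) (h : SatisfiesRelations G a) :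
    SatisfiesRelations (G.comap f) fun x => a (f x) where
  unitary _ := h.unitary _
  sq _ := h.sq _
  commute _ _ hxy := h.commute _ _ hxy
  anticommute _ _ hxy := h.anticommute _ _ hxy

theorem mul_comm_sgn (h : SatisfiesRelations G a) (v x : V) :
    a v * a x = sgn (adjForm G v (Finsupp.single x 1)) • (a x * a v) := by
  classical
  rw [adjForm_single]
  split_ifs with hvx
  · rw [h.anticommute v x hvx, sgn_one, neg_one_smul]
  · rw [h.commute v x hvx, sgn_zero, one_smul]

/-- Each letter passed by `a v` contributes its own sign, and the signs add up to a character of the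
content. Triviality or nontriviality of this character decides both central words and vanishing
traces. -/
theorem mul_wordProd (h : SatisfiesRelations G a) (v : V) (l : List V) :
    a v * wordProd a l = sgn (adjForm G v (content l)) • (wordProd a l * a v) := by
  induction l with
  | nil => simp
  | cons x l ih =>
    rw [content_cons, map_add, sgn_add, wordProd_cons, ← mul_assoc, h.mul_comm_sgn,
      smul_mul_assoc, mul_assoc, ih, mul_smul_comm, smul_smul, mul_assoc]

theorem star_wordProd (h : SatisfiesRelations G a) (l : List V) :
    star (wordProd a l) = wordProd a l.reverse := by
  induction l with
  | nil => simp
  | cons x l ih => simp [ih, h.star_eq]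

theorem star_wordProd_mul_self (h : SatisfiesRelations G a) (l : List V) :
    star (wordProd a l) * wordProd a l = 1 := by
  induction l with
  | nil => simp
  | cons x l ih =>
    rw [wordProd_cons, star_mul, mul_assoc, ← mul_assoc _ (a x), h.star_eq, h.mul_self, one_mul,
      ih]

theorem wordProd_mul_star_self (h : SatisfiesRelations G a) (l : List V) :
    wordProd a l * star (wordProd a l) = 1 := by
  have := h.star_wordProd_mul_self l.reverse
  rwa [h.star_wordProd, List.reverse_reverse, ← h.star_wordProd] at this

/-- The first letter must occur again. Moving it next to that occurrence costs a sign, the pair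
cancels, and a shorter word of zero content remains. -/
theorem wordProd_of_content_eq_zero (h : SatisfiesRelations G a) {l : List V}
    (hl : content l = 0) : ∃ c : ZMod 2, wordProd a l = sgn c • 1 := by
  induction hn : l.length using Nat.strong_induction_on generalizing l with
  | _ n ih =>
    cases l with
    | nil => exact ⟨0, by simp⟩
    | cons x l =>
      have hx : x ∈ l := by
        by_contra hx
        have := DFunLike.congr_fun hl x
        simp [content_apply_of_notMem hx] at this
      obtain ⟨m, k, rfl⟩ := List.append_of_mem hx
      have hc : content (m ++ k) = 0 := by
        simp only [content_cons, content_append] at hl ⊢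
        have := finsupp_add_self (Finsupp.single x (1 : ZMod 2))
        calc content m + content k
            = (Finsupp.single x 1 + Finsupp.single x 1) + (content m + content k) := by
              rw [this, zero_add]
          _ = 0 := by rw [← hl]; abel
      obtain ⟨c, hmk⟩ := ih _ (by subst hn; simp) hc rfl
      refine ⟨adjForm G x (content m) + c, ?_⟩
      rw [sgn_add, mul_smul, ← hmk, wordProd_cons, wordProd_append, wordProd_append,
        wordProd_cons, ← mul_assoc, h.mul_wordProd, smul_mul_assoc, mul_assoc,
        ← mul_assoc (a x), h.mul_self, one_mul]

/-- The adjoint of a word is its reversal, so `l` followed by the reversal of `m` has zero content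
and is a sign. -/
theorem wordProd_of_content_eq (h : SatisfiesRelations G a) {l m : List V}
    (hl : content l = content m) : ∃ c : ZMod 2, wordProd a l = sgn c • wordProd a m := by
  obtain ⟨c, hc⟩ := h.wordProd_of_content_eq_zero (l := l ++ m.reverse)
    (by rw [content_append, content_reverse, hl, finsupp_add_self])
  refine ⟨c, ?_⟩
  rw [wordProd_append, ← h.star_wordProd] at hc
  calc wordProd a l = wordProd a l * star (wordProd a m) * wordProd a m := by
        rw [mul_assoc, h.star_wordProd_mul_self, mul_one]
    _ = _ := by rw [hc, smul_mul_assoc, one_mul]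

end SatisfiesRelations

end Relations

/-! ### Words in the generators of `B(G)` -/

namespace B

variable {V : Type u} {G : SimpleGraph V}

theorem ofFree_mono (m : FreeMonoid V) (c : ℂ) :
    ofFree G (mono m c) = c • wordProd (gen G) m.toList := by
  have : mono m c = c • mono m 1 := by rw [smul_mono, mul_one]
  rw [this, map_smul]
  congr 1
  induction m using FreeMonoid.recOn with
  | one => rw [← one_def, map_one]; rfl
  | of_mul x m ih =>
    have e : mono (FreeMonoid.of x * m) 1 = FreeStarAlgebra.gen x * mono m 1 := by
      rw [FreeStarAlgebra.gen, mono_mul_mono, one_mul]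
    rw [e, map_mul, ih (by rw [smul_mono, mul_one])]
    exact (wordProd_cons (gen G) x m.toList).symm

theorem ofFree_mem_span (f : FreeStarAlgebra V) :
    ofFree G f ∈ Submodule.span ℂ (Set.range (wordProd (gen G))) := by
  induction f using FreeStarAlgebra.induction_linear with
  | zero => rw [map_zero]; exact Submodule.zero_mem _
  | add x y hx hy => rw [map_add]; exact Submodule.add_mem _ hx hy
  | mono m c =>
    rw [ofFree_mono]
    exact Submodule.smul_mem _ _ (Submodule.subset_span ⟨_, rfl⟩)

theorem dense_span_words :
    Dense (Submodule.span ℂ (Set.range (wordProd (gen G))) : Set (B G)) :=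
  (denseRange_ofFree G).mono (by rintro _ ⟨f, rfl⟩; exact ofFree_mem_span f)

/-- Continuous linear maps on `B(G)` agreeing on words are equal. -/
theorem eq_of_words {E : Type w} [AddCommGroup E] [Module ℂ E] [TopologicalSpace E] [T2Space E]
    {f g : B G →ₗ[ℂ] E} (hf : Continuous f) (hg : Continuous g)
    (h : ∀ l, f (wordProd (gen G) l) = g (wordProd (gen G) l)) : f = g := by
  refine DFunLike.coe_injective (Continuous.ext_on dense_span_words hf hg ?_)
  exact LinearMap.eqOn_span (by rintro _ ⟨l, rfl⟩; exact h l)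

/-- The `*`-homomorphism on `B(G)` with prescribed values on the generators. -/
def lift {A : Type v} [CStarAlgebra A] {a : V → A} (ha : SatisfiesRelations G a) :
    B G →⋆ₐ[ℂ] A := (existsUnique_lift G a ha).choose

@[simp] theorem lift_gen {A : Type v} [CStarAlgebra A] {a : V → A} (ha : SatisfiesRelations G a)
    (x : V) : lift ha (gen G x) = a x := (existsUnique_lift G a ha).choose_spec.1 x

theorem lift_wordProd {A : Type v} [CStarAlgebra A] {a : V → A} (ha : SatisfiesRelations G a)
    (l : List V) : lift ha (wordProd (gen G) l) = wordProd a l := by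
  rw [map_wordProd]; simp

theorem hom_ext {A : Type v} [CStarAlgebra A] {φ ψ : B G →⋆ₐ[ℂ] A}
    (h : ∀ x, φ (gen G x) = ψ (gen G x)) : φ = ψ :=
  (existsUnique_lift G _ ((satisfiesRelations_gen G).map ψ)).unique h fun _ => rfl

/-- Functoriality of `B(G)` in the graph. -/
def mapComap {W : Type w} (f : W → V) (G : SimpleGraph V) : B (G.comap f) →⋆ₐ[ℂ] B G :=
  lift ((satisfiesRelations_gen G).comap f)

@[simp] theorem mapComap_gen {W : Type w} (f : W → V) (x : W) :
    mapComap f G (gen _ x) = gen G (f x) := lift_gen _ x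

theorem mapComap_wordProd {W : Type w} (f : W → V) (l : List W) :
    mapComap f G (wordProd (gen _) l) = wordProd (gen G) (l.map f) := by
  rw [mapComap, lift_wordProd, wordProd_map]

end B

attribute [local irreducible] instCStarAlgebraB

/-! ### The canonical representation -/

section Representation

variable {V : Type u}

/-- The Hilbert space of square summable functions on the group of contents. -/
abbrev ContentSpace (V : Type u) : Type u := lp (fun _ : V →₀ ZMod 2 => ℂ) 2

/-- The operator `f ↦ (s ↦ sgn (b s) f (s + t))`. -/
def twistedShift (b : (V →₀ ZMod 2) →+ ZMod 2) (t : V →₀ ZMod 2) :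
    ContentSpace V →ₗᵢ[ℂ] ContentSpace V where
  toFun f := ⟨fun s => sgn (b s) * f (s + t), by
    refine memℓp_gen ?_
    simp only [norm_mul, norm_sgn, one_mul]
    -- Signs do not affect absolute values, and translation by `t` permutes the index set.
    exact (Equiv.addRight t).summable_iff.mpr ((lp.memℓp f).summable (by norm_num))⟩
  map_add' f g := by ext s; exact mul_add _ _ _
  map_smul' c f := by ext s; exact mul_left_comm _ _ _
  norm_map' f := by
    have hp : (0 : ℝ) < (2 : ENNReal).toReal := by norm_num
    refine (Real.rpow_left_inj (norm_nonneg _) (norm_nonneg _) hp.ne').mp ?_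
    rw [lp.norm_rpow_eq_tsum hp, lp.norm_rpow_eq_tsum hp]
    simp only [LinearMap.coe_mk, AddHom.coe_mk, norm_mul, norm_sgn, one_mul]
    exact (Equiv.addRight t).tsum_eq fun s => ‖f s‖ ^ (2 : ENNReal).toReal

theorem twistedShift_apply (b : (V →₀ ZMod 2) →+ ZMod 2) (t : V →₀ ZMod 2) (f : ContentSpace V)
    (s : V →₀ ZMod 2) : twistedShift b t f s = sgn (b s) * f (s + t) := rfl

theorem twistedShift_mul_apply (b c : (V →₀ ZMod 2) →+ ZMod 2) (t r : V →₀ ZMod 2)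
    (f : ContentSpace V) (s : V →₀ ZMod 2) : twistedShift b t (twistedShift c r f) s =
      sgn (c t) * (sgn (b s + c s) * f (s + t + r)) := by
  rw [twistedShift_apply, twistedShift_apply, map_add, sgn_add, sgn_add]
  ring

open Classical in
theorem twistedShift_single (b : (V →₀ ZMod 2) →+ ZMod 2) (t s : V →₀ ZMod 2) (c : ℂ) :
    twistedShift b t (lp.single 2 s c) = sgn (b (t + s)) • lp.single 2 (t + s) c := by
  ext r
  rw [twistedShift_apply, lp.coeFn_smul, Pi.smul_apply, lp.single_apply, lp.single_apply,
    smul_eq_mul]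
  by_cases h : r = t + s
  · have : r + t = s := by rw [h, add_comm t s, add_assoc, finsupp_add_self, add_zero]
    rw [this, h, Pi.single_eq_same, Pi.single_eq_same]
  · have : r + t ≠ s := by
      rintro rfl
      exact h (by rw [add_comm r t, ← add_assoc, finsupp_add_self, zero_add])
    rw [Pi.single_eq_of_ne this, Pi.single_eq_of_ne h, mul_zero, mul_zero]

variable (G : SimpleGraph V)

open Classical in
/-- Counts modulo `2` the neighbours of `x` which precede `x` in a fixed well-ordering. -/
def precForm (x : V) : (V →₀ ZMod 2) →+ ZMod 2 :=
  Finsupp.liftAddHom fun y => if G.Adj x y ∧ WellOrderingRel y x then AddMonoidHom.id _ else 0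

open Classical in
theorem precForm_single (x y : V) : precForm G x (Finsupp.single y 1) =
    if G.Adj x y ∧ WellOrderingRel y x then 1 else 0 := by
  rw [precForm, Finsupp.liftAddHom_apply_single]
  split_ifs <;> rfl

theorem precForm_self (x : V) : precForm G x (Finsupp.single x 1) = 0 := by
  simp [precForm_single]

theorem precForm_symm_of_not_adj {x y : V} (h : ¬ G.Adj x y) :
    precForm G x (Finsupp.single y 1) = precForm G y (Finsupp.single x 1) := by
  simp [precForm_single, h, G.adj_comm y x]

/-- Exactly one of two adjacent vertices precedes the other. Thus `precForm` is an asymmetric form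
whose symmetrization modulo 2 is adjacency, which makes the twisted shifts of adjacent vertices
anticommute. -/
theorem precForm_symm_of_adj {x y : V} (h : G.Adj x y) :
    precForm G x (Finsupp.single y 1) = 1 + precForm G y (Finsupp.single x 1) := by
  rcases trichotomous_of (WellOrderingRel (α := V)) x y with hxy | hxy | hxy
  · simp [precForm_single, h, h.symm, hxy, asymm_of WellOrderingRel hxy,
      show (1 + 1 : ZMod 2) = 0 from rfl]
  · exact absurd hxy h.ne
  · simp [precForm_single, h, h.symm, hxy, asymm_of WellOrderingRel hxy]

/-- The unitary attached to a vertex in the canonical representation. -/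
def canonicalUnitary (x : V) : ContentSpace V →L[ℂ] ContentSpace V :=
  (twistedShift (precForm G x) (Finsupp.single x 1)).toContinuousLinearMap

theorem canonicalUnitary_apply (x : V) (f : ContentSpace V) : canonicalUnitary G x f =
    twistedShift (precForm G x) (Finsupp.single x 1) f := rfl

theorem canonicalUnitary_mul_self (x : V) :
    canonicalUnitary G x * canonicalUnitary G x = 1 := by
  ext f s
  rw [mul_apply_eq_comp, canonicalUnitary_apply, canonicalUnitary_apply,
    twistedShift_mul_apply, precForm_self, CharTwo.add_self_eq_zero, add_assoc, finsupp_add_self]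
  simp

theorem star_canonicalUnitary (x : V) :
    star (canonicalUnitary G x) = canonicalUnitary G x := by
  have h : star (canonicalUnitary G x) * canonicalUnitary G x = 1 :=
    ContinuousLinearMap.norm_map_iff_adjoint_comp_self _ |>.mp
      (twistedShift (precForm G x) (Finsupp.single x 1)).norm_map
  calc star (canonicalUnitary G x)
      = star (canonicalUnitary G x) * (canonicalUnitary G x * canonicalUnitary G x) := by
        rw [canonicalUnitary_mul_self, mul_one]
    _ = _ := by rw [← mul_assoc, h, one_mul]

theorem satisfiesRelations_canonicalUnitary : SatisfiesRelations G (canonicalUnitary G) where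
  unitary x := by
    rw [Unitary.mem_iff, star_canonicalUnitary, canonicalUnitary_mul_self]
    exact ⟨rfl, rfl⟩
  sq x := by rw [pow_two, canonicalUnitary_mul_self]
  commute x y h := by
    ext f s
    simp only [mul_apply_eq_comp, canonicalUnitary_apply, twistedShift_mul_apply]
    rw [← precForm_symm_of_not_adj G h, add_comm (precForm G x s), add_right_comm s]
  anticommute x y h := by
    ext f s
    simp only [mul_apply_eq_comp, neg_apply, lp.coeFn_neg,
      Pi.neg_apply, canonicalUnitary_apply, twistedShift_mul_apply]
    rw [precForm_symm_of_adj G h.symm, add_comm (precForm G x s), add_right_comm s, sgn_add,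
      sgn_one]
    ring

open Classical in
/-- The basis vector of the Hilbert space at the zero content. -/
def vacuum (V : Type u) : ContentSpace V := lp.single 2 0 1

/-- This makes the vacuum orthogonal to its image under any word of nonzero content, and lets words
carry the vacuum to every basis vector up to a phase. -/
theorem wordProd_canonicalUnitary_vacuum (l : List V) : ∃ c : ℂ, ‖c‖ = 1 ∧
    wordProd (canonicalUnitary G) l (vacuum V) =
      c • (by classical exact lp.single 2 (content l) 1) := by
  induction l with
  | nil => exact ⟨1, norm_one, by simp [vacuum]⟩
  | cons x l ih =>
    obtain ⟨c, hc, h⟩ := ih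
    refine ⟨c * sgn (precForm G x (Finsupp.single x 1 + content l)),
      by rw [norm_mul, hc, norm_sgn, one_mul], ?_⟩
    rw [wordProd_cons, mul_apply_eq_comp, h, map_smul, canonicalUnitary_apply,
      twistedShift_single, smul_smul]
    rfl

/-- The canonical representation of `B(G)`. -/
def canonicalRep : B G →⋆ₐ[ℂ] (ContentSpace V →L[ℂ] ContentSpace V) :=
  B.lift (satisfiesRelations_canonicalUnitary G)

/-- The vector state of the canonical representation at the vacuum. -/
def canonicalTrace : B G →ₗ[ℂ] ℂ :=
  (innerₛₗ ℂ (vacuum V)).comp ((ContinuousLinearMap.apply ℂ _ (vacuum V)).toLinearMap.comp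
    (canonicalRep G).toAlgHom.toLinearMap)

theorem canonicalTrace_apply (a : B G) :
    canonicalTrace G a = inner ℂ (vacuum V) (canonicalRep G a (vacuum V)) := rfl

theorem norm_vacuum : ‖vacuum V‖ = 1 := by
  classical
  rw [vacuum, lp.norm_single (by norm_num), norm_one]

theorem norm_canonicalTrace_le (a : B G) : ‖canonicalTrace G a‖ ≤ ‖a‖ := by
  rw [canonicalTrace_apply]
  calc _ ≤ ‖vacuum V‖ * ‖canonicalRep G a (vacuum V)‖ := norm_inner_le_norm _ _
    _ ≤ ‖vacuum V‖ * (‖canonicalRep G a‖ * ‖vacuum V‖) := by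
        gcongr; exact ContinuousLinearMap.le_opNorm _ _
    _ ≤ _ := by
        rw [norm_vacuum, one_mul, mul_one]
        exact NonUnitalStarAlgHom.norm_apply_le _ _

theorem continuous_canonicalTrace : Continuous (canonicalTrace G) :=
  AddMonoidHomClass.continuous_of_bound _ 1 fun a => by
    rw [one_mul]; exact norm_canonicalTrace_le G a

theorem canonicalTrace_one : canonicalTrace G 1 = 1 := by
  rw [canonicalTrace_apply, map_one, one_apply_eq_self, inner_self_eq_norm_sq_to_K,
    norm_vacuum]
  simp

theorem canonicalTrace_wordProd {l : List V} (hl : content l ≠ 0) :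
    canonicalTrace G (wordProd (B.gen G) l) = 0 := by
  classical
  obtain ⟨c, -, hc⟩ := wordProd_canonicalUnitary_vacuum G l
  rw [canonicalTrace_apply, canonicalRep, B.lift_wordProd, hc, vacuum, lp.inner_single_left,
    lp.coeFn_smul, Pi.smul_apply, lp.single_apply, Pi.single_eq_of_ne hl.symm]
  simp

theorem canonicalTrace_star_mul_self (a : B G) :
    canonicalTrace G (star a * a) = ((‖canonicalRep G a (vacuum V)‖ ^ 2 : ℝ) : ℂ) := by
  rw [canonicalTrace_apply, map_mul, map_star, mul_apply_eq_comp,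
    ContinuousLinearMap.star_eq_adjoint, ContinuousLinearMap.adjoint_inner_right,
    inner_self_eq_norm_sq_to_K]
  simp

theorem canonicalTrace_mul_comm_words (l m : List V) :
    canonicalTrace G (wordProd (B.gen G) l * wordProd (B.gen G) m) =
      canonicalTrace G (wordProd (B.gen G) m * wordProd (B.gen G) l) := by
  have h := B.satisfiesRelations_gen G
  by_cases hc : content (l ++ m) = 0
  · obtain ⟨c, hc⟩ := h.wordProd_of_content_eq_zero hc
    rw [wordProd_append] at hc
    -- The product in the other order is a conjugate of the first by a unitary word, and a scalar is
    -- its own conjugate.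
    have : wordProd (B.gen G) m * wordProd (B.gen G) l = sgn c • 1 :=
      calc wordProd (B.gen G) m * wordProd (B.gen G) l
          = star (wordProd (B.gen G) l) * (wordProd (B.gen G) l * wordProd (B.gen G) m) *
              wordProd (B.gen G) l := by
            rw [← mul_assoc (star _), h.star_wordProd_mul_self, one_mul]
        _ = _ := by rw [hc, mul_smul_comm, mul_one, smul_mul_assoc, h.star_wordProd_mul_self]
    rw [hc, this]
  · rw [← wordProd_append, ← wordProd_append, canonicalTrace_wordProd G hc,
      canonicalTrace_wordProd G (by rwa [content_append, add_comm, ← content_append])]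

theorem isTrace_canonicalTrace : IsTrace (canonicalTrace G) where
  nonneg a := by
    rw [canonicalTrace_star_mul_self, Complex.ofReal_re, Complex.ofReal_im]
    exact ⟨by positivity, rfl⟩
  map_one := canonicalTrace_one G
  map_mul_comm a b := by
    have hc := continuous_canonicalTrace G
    have h1 (m : List V) (a : B G) : canonicalTrace G (a * wordProd (B.gen G) m) =
        canonicalTrace G (wordProd (B.gen G) m * a) :=
      LinearMap.congr_fun (B.eq_of_words
        (f := (canonicalTrace G).comp (LinearMap.mulRight ℂ (wordProd (B.gen G) m)))
        (g := (canonicalTrace G).comp (LinearMap.mulLeft ℂ (wordProd (B.gen G) m)))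
        (hc.comp (continuous_mul_const _)) (hc.comp (continuous_const_mul _))
        fun l => canonicalTrace_mul_comm_words G l m) a
    exact LinearMap.congr_fun (B.eq_of_words
        (f := (canonicalTrace G).comp (LinearMap.mulLeft ℂ a))
        (g := (canonicalTrace G).comp (LinearMap.mulRight ℂ a))
        (hc.comp (continuous_const_mul _)) (hc.comp (continuous_mul_const _))
        fun m => h1 m a) b

end Representation

/-! ### Finite graphs and faithfulness of the canonical representation -/

section Faithful

variable {V : Type u}

theorem finite_contents (V : Type u) [Finite V] : Finite (V →₀ ZMod 2) :=
  Finsupp.equivFunOnFinite.finite_iff.mpr inferInstance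

namespace B

/-- One representative per content suffices because words of equal content agree up to sign. For
finite `V` this bounds the dimension. -/
theorem span_words_wordOf (G : SimpleGraph V) :
    Submodule.span ℂ (Set.range (wordProd (gen G))) =
      Submodule.span ℂ (Set.range fun s => wordProd (gen G) (wordOf s)) := by
  refine le_antisymm (Submodule.span_le.mpr ?_)
    (Submodule.span_mono (by rintro _ ⟨s, rfl⟩; exact ⟨_, rfl⟩))
  rintro _ ⟨l, rfl⟩
  obtain ⟨c, hc⟩ := (satisfiesRelations_gen G).wordProd_of_content_eq
    (content_wordOf (content l)).symm
  rw [hc]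
  exact Submodule.smul_mem _ _ (Submodule.subset_span ⟨_, rfl⟩)

variable [Finite V] (G : SimpleGraph V)

theorem span_words_eq_top : Submodule.span ℂ (Set.range (wordProd (gen G))) = ⊤ := by
  have := finite_contents V
  have : FiniteDimensional ℂ (Submodule.span ℂ (Set.range (wordProd (gen G)))) := by
    rw [span_words_wordOf]
    exact FiniteDimensional.span_of_finite ℂ (Set.finite_range _)
  have hc := Submodule.closed_of_finiteDimensional
    (Submodule.span ℂ (Set.range (wordProd (gen G))))
  rw [← SetLike.coe_set_eq, Submodule.top_coe, ← hc.closure_eq]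
  exact dense_span_words.closure_eq

instance : FiniteDimensional ℂ (B G) := by
  have := finite_contents V
  refine ⟨?_⟩
  rw [← span_words_eq_top G, span_words_wordOf]
  exact Submodule.fg_span (Set.finite_range _)

/-- A `*`-homomorphism on the algebra of a finite graph is injective as soon as some functional
on its target annihilates all words of nonzero content but not the unit. -/
theorem injective_of_functional {A : Type v} [CStarAlgebra A] (φ : B G →⋆ₐ[ℂ] A) (ρ : A →ₗ[ℂ] ℂ)
    (h1 : ρ 1 = 1) (h0 : ∀ l, content l ≠ 0 → ρ (φ (wordProd (gen G) l)) = 0) :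
    Function.Injective φ := by
  have := finite_contents V
  have := Fintype.ofFinite (V →₀ ZMod 2)
  have h := satisfiesRelations_gen G
  refine (injective_iff_map_eq_zero φ).mpr fun a ha => ?_
  have hmem : a ∈ Submodule.span ℂ (Set.range fun s => wordProd (gen G) (wordOf s)) := by
    rw [← span_words_wordOf, span_words_eq_top]; trivial
  obtain ⟨c, rfl⟩ := (Submodule.mem_span_range_iff_exists_fun ℂ).mp hmem
  -- The functional reads off the coefficient at `t`: after multiplying by the adjoint of the word
  -- of `t`, only that term has zero content.
  have hc (t : V →₀ ZMod 2) : c t = 0 := by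
    have h2 : ρ (φ (star (wordProd (gen G) (wordOf t)) *
        ∑ s, c s • wordProd (gen G) (wordOf s))) = 0 := by
      rw [map_mul, ha, mul_zero, map_zero]
    rw [Finset.mul_sum, map_sum, map_sum, Finset.sum_eq_single t] at h2
    · rwa [mul_smul_comm, h.star_wordProd_mul_self, map_smul, map_one, map_smul, h1, smul_eq_mul,
        mul_one] at h2
    · intro s _ hst
      rw [mul_smul_comm, map_smul, map_smul, h.star_wordProd, ← wordProd_append, h0, smul_zero]
      rw [content_append, content_reverse, content_wordOf, content_wordOf]
      intro he
      apply hst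
      calc s = (t + t) + s := by rw [finsupp_add_self, zero_add]
        _ = t := by rw [add_assoc, he, add_zero]
    · exact fun ht => absurd (Finset.mem_univ t) ht
  simp [hc]

end B

variable (G : SimpleGraph V)

/-- The algebra of the subgraph induced on `T`, mapped into `B(G)`. -/
def inducedMap (T : Set V) : B (G.induce T) →⋆ₐ[ℂ] B G := B.mapComap Subtype.val G

@[simp] theorem inducedMap_gen (T : Set V) (x : T) :
    inducedMap G T (B.gen _ x) = B.gen G x := B.mapComap_gen _ x

/-- The map between algebras of induced subgraphs given by an inclusion of vertex sets. -/
def inclusionMap {S T : Set V} (h : S ⊆ T) : B (G.induce S) →⋆ₐ[ℂ] B (G.induce T) :=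
  B.mapComap (Set.inclusion h) (G.induce T)

@[simp] theorem inclusionMap_gen {S T : Set V} (h : S ⊆ T) (x : S) :
    inclusionMap G h (B.gen _ x) = B.gen (G.induce T) (Set.inclusion h x) := B.mapComap_gen _ x

theorem inducedMap_inclusionMap {S T : Set V} (h : S ⊆ T) (a : B (G.induce S)) :
    inducedMap G T (inclusionMap G h a) = inducedMap G S a := by
  refine DFunLike.congr_fun (f := (inducedMap G T).comp (inclusionMap G h)) (B.hom_ext fun x => ?_) a
  rw [StarAlgHom.comp_apply, inclusionMap_gen, inducedMap_gen, inducedMap_gen]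

theorem canonicalRep_inducedMap_injective (T : Set V) [Finite T] :
    Function.Injective ((canonicalRep G).comp (inducedMap G T)) := by
  refine B.injective_of_functional _ _ ((innerₛₗ ℂ (vacuum V)).comp
    (ContinuousLinearMap.apply ℂ _ (vacuum V)).toLinearMap) ?_ ?_
  · rw [← map_one (canonicalRep G)]
    exact canonicalTrace_one G
  · intro l hl
    have : inducedMap G T (wordProd (B.gen _) l) = wordProd (B.gen G) (l.map Subtype.val) :=
      B.mapComap_wordProd _ l
    rw [StarAlgHom.comp_apply, this]
    refine canonicalTrace_wordProd G ?_
    rw [content_map]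
    intro h0
    exact hl (Finsupp.mapDomain_injective Subtype.val_injective (by rw [h0, Finsupp.mapDomain_zero]))

/-- Injectivity is inherited from the composite with `canonicalRep`, and injective `*`-homomorphisms
of C*-algebras are isometric. -/
theorem norm_inducedMap (T : Set V) [Finite T] (a : B (G.induce T)) :
    ‖inducedMap G T a‖ = ‖a‖ := by
  refine NonUnitalStarAlgHom.norm_map (inducedMap G T) (fun x y hxy => ?_) a
  refine canonicalRep_inducedMap_injective G T ?_
  rw [StarAlgHom.comp_apply, hxy, StarAlgHom.comp_apply]

theorem wordProd_mem_range_inducedMap {T : Set V} {l : List V} (h : ∀ x ∈ l, x ∈ T) :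
    wordProd (B.gen G) l ∈ Set.range (inducedMap G T) := by
  lift l to List T using h
  exact ⟨_, B.mapComap_wordProd _ l⟩

/-- The claim covers all larger `T'` so that the set can later be enlarged to a member of a cofinal
family. -/
theorem exists_finset_range_inducedMap (f : FreeStarAlgebra V) : ∃ T : Finset V,
    ∀ T' : Set V, (T : Set V) ⊆ T' → B.ofFree G f ∈ Set.range (inducedMap G T') := by
  classical
  induction f using FreeStarAlgebra.induction_linear with
  | zero => exact ⟨∅, fun T' _ => ⟨0, by rw [map_zero, map_zero]⟩⟩
  | add f g hf hg =>
    obtain ⟨S, hS⟩ := hf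
    obtain ⟨T, hT⟩ := hg
    refine ⟨S ∪ T, fun T' h => ?_⟩
    rw [Finset.coe_union, Set.union_subset_iff] at h
    obtain ⟨x, hx⟩ := hS T' h.1
    obtain ⟨y, hy⟩ := hT T' h.2
    exact ⟨x + y, by rw [map_add, hx, hy, map_add]⟩
  | mono m c =>
    refine ⟨m.toList.toFinset, fun T' h => ?_⟩
    obtain ⟨x, hx⟩ := wordProd_mem_range_inducedMap G (T := T') (l := m.toList)
      fun x hx => h (by simpa using hx)
    exact ⟨c • x, by rw [map_smul, hx, B.ofFree_mono]⟩

/-- The representation is injective, hence isometric, on the algebra of each finite induced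
subgraph, and these algebras have dense union. -/
theorem norm_canonicalRep (a : B G) : ‖canonicalRep G a‖ = ‖a‖ := by
  have hc : Continuous (canonicalRep G) := AddMonoidHomClass.continuous_of_bound _ 1 fun x => by
    rw [one_mul]; exact NonUnitalStarAlgHom.norm_apply_le _ x
  refine (B.denseRange_ofFree G).induction_on (p := fun a => ‖canonicalRep G a‖ = ‖a‖) a
    (isClosed_eq hc.norm continuous_norm) fun f => ?_
  obtain ⟨T, hT⟩ := exists_finset_range_inducedMap G f
  obtain ⟨x, hx⟩ := hT T subset_rfl
  rw [← hx, norm_inducedMap]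
  exact NonUnitalStarAlgHom.norm_map _ (canonicalRep_inducedMap_injective G T) x

/-- By traciality, right multiplication of `a` by a unitary word does not change the trace of `star
a * a`. Hence `a` annihilates the image of the vacuum under every word, that is, every basis vector,
and is zero. -/
theorem canonicalTrace_faithful {a : B G} (ha : canonicalTrace G (star a * a) = 0) : a = 0 := by
  classical
  have key {b : B G} (hb : canonicalTrace G (star b * b) = 0) :
      canonicalRep G b (vacuum V) = 0 := by
    rw [canonicalTrace_star_mul_self] at hb
    simpa using hb
  have hword (l : List V) :
      canonicalRep G a (by classical exact lp.single 2 (content l) 1) = 0 := by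
    obtain ⟨c, hc, h⟩ := wordProd_canonicalUnitary_vacuum G l
    have h2 : canonicalTrace G (star (a * wordProd (B.gen G) l) * (a * wordProd (B.gen G) l))
        = 0 := by
      rw [star_mul, mul_assoc, (isTrace_canonicalTrace G).map_mul_comm, mul_assoc, mul_assoc,
        (B.satisfiesRelations_gen G).wordProd_mul_star_self, mul_one, ha]
    have h3 := key h2
    rw [map_mul, mul_apply_eq_comp, canonicalRep, B.lift_wordProd, h, map_smul,
      smul_eq_zero] at h3
    exact h3.resolve_left (norm_ne_zero_iff.mp (by rw [hc]; exact one_ne_zero))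
  rw [← norm_eq_zero, ← norm_canonicalRep, norm_eq_zero]
  ext1 f
  rw [zero_apply]
  have hf := (lp.hasSum_single (p := 2) (by norm_num) f).mapL (canonicalRep G a)
  refine hf.unique ?_
  convert hasSum_zero with s
  have : lp.single (E := fun _ : V →₀ ZMod 2 => ℂ) 2 s (f s) = f s • lp.single 2 s 1 := by
    rw [← lp.single_smul, smul_eq_mul, mul_one]
  rw [this, map_smul]
  have h4 := hword (wordOf s)
  rw [content_wordOf] at h4
  rw [h4, smul_zero]

instance : Nontrivial (B G) :=
  ⟨⟨1, 0, fun h => by simpa [h] using canonicalTrace_one G⟩⟩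

end Faithful

/-! ### Traces -/

section Traces

-- Positivity on the elements `star a * a` is positivity for the spectral order, and positive
-- functionals on a C*-algebra are bounded.
open scoped ComplexOrder in
theorem IsTrace.continuous {A : Type v} [CStarAlgebra A] {τ : A →ₗ[ℂ] ℂ} (hτ : IsTrace τ) :
    Continuous τ := by
  let _ := CStarAlgebra.spectralOrder A
  have := CStarAlgebra.spectralOrderedRing A
  obtain ⟨C, hC⟩ := (PositiveLinearMap.mk₀ τ fun x hx => by
    obtain ⟨y, rfl⟩ := CStarAlgebra.nonneg_iff_eq_star_mul_self.mp hx
    rw [Complex.nonneg_iff]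
    exact ⟨(hτ.nonneg y).1, (hτ.nonneg y).2.symm⟩).exists_norm_apply_le
  exact AddMonoidHomClass.continuous_of_bound τ C hC

/-- Products of matrix units show that `f` kills the off-diagonal ones and agrees on the diagonal
ones, whose sum is the identity. -/
theorem tracial_matrix_apply {n : Type*} [Fintype n] [DecidableEq n] {f : Matrix n n ℂ →ₗ[ℂ] ℂ}
    (h1 : f 1 = 1) (hf : ∀ a b, f (a * b) = f (b * a)) (a : Matrix n n ℂ) :
    Fintype.card n * f a = a.trace := by
  have hne {i j : n} (hij : i ≠ j) (c : ℂ) : f (Matrix.single i j c) = 0 := by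
    have := hf (Matrix.single i i 1) (Matrix.single i j c)
    rwa [Matrix.single_mul_single_same, one_mul, Matrix.single_mul_single_of_ne _ _ _ _ hij.symm,
      map_zero] at this
  have heq (i j : n) (c : ℂ) : f (Matrix.single i i c) = f (Matrix.single j j c) := by
    have := hf (Matrix.single i j 1) (Matrix.single j i c)
    rwa [Matrix.single_mul_single_same, Matrix.single_mul_single_same, one_mul, mul_one] at this
  have hdiag (i : n) (c : ℂ) : Fintype.card n * f (Matrix.single i i c) = c := by
    have hc : ∑ j, Matrix.single j j c = c • (1 : Matrix n n ℂ) := by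
      rw [← Matrix.diagonal_one, ← Matrix.diagonal_smul, ← Matrix.sum_single_eq_diagonal]
      simp
    calc Fintype.card n * f (Matrix.single i i c) = ∑ j, f (Matrix.single j j c) := by
          rw [Finset.sum_congr rfl fun j _ => heq j i c, Finset.sum_const, Finset.card_univ,
            nsmul_eq_mul]
      _ = c := by rw [← map_sum, hc, map_smul, h1, smul_eq_mul, mul_one]
  induction a using Matrix.induction_on' with
  | h_zero => simp
  | h_add p q hp hq => rw [map_add, mul_add, hp, hq, Matrix.trace_add]
  | h_std_basis i j c =>
    by_cases hij : i = j
    · subst hij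
      rw [hdiag, Matrix.trace_single_eq_same]
    · rw [hne hij, mul_zero, Matrix.trace_single_eq_of_ne _ _ _ hij]

theorem IsFullMatrixAlgebra.tracial_unique {D : Type v} [CStarAlgebra D]
    (hD : IsFullMatrixAlgebra D) {f g : D →ₗ[ℂ] ℂ} (hf1 : f 1 = 1) (hg1 : g 1 = 1)
    (hf : ∀ a b, f (a * b) = f (b * a)) (hg : ∀ a b, g (a * b) = g (b * a)) (a : D) :
    f a = g a := by
  obtain ⟨n, hn, ⟨e⟩⟩ := hD
  have key (f : D →ₗ[ℂ] ℂ) (h1 : f 1 = 1) (hf : ∀ a b, f (a * b) = f (b * a)) :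
      (n : ℂ) * f a = (e a).trace := by
    have := tracial_matrix_apply
      (f := f.comp (e.symm : Matrix (Fin n) (Fin n) ℂ →⋆ₐ[ℂ] D).toAlgHom.toLinearMap)
      (by simpa using h1) (fun a b => by simpa using hf _ _) (e a)
    simpa using this
  have hn0 : (n : ℂ) ≠ 0 := by exact_mod_cast (by omega : n ≠ 0)
  exact mul_left_cancel₀ hn0 ((key f hf1 hf).trans (key g hg1 hg).symm)

theorem IsAM.trace_unique {A : Type v} [CStarAlgebra A] (hA : IsAM A) {τ σ : A →ₗ[ℂ] ℂ}
    (hτ : IsTrace τ) (hσ : IsTrace σ) : τ = σ := by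
  obtain ⟨I, _, _, _, D, _, f, ι, hD, hlim⟩ := hA
  refine DFunLike.coe_injective (Continuous.ext_on hlim.dense hτ.continuous hσ.continuous ?_)
  intro x hx
  obtain ⟨i, a, rfl⟩ := Set.mem_iUnion.mp hx
  refine (hD i).tracial_unique (f := τ.comp (ι i).toAlgHom.toLinearMap)
    (g := σ.comp (ι i).toAlgHom.toLinearMap) ?_ ?_ ?_ ?_ a
  · simpa using hτ.map_one
  · simpa using hσ.map_one
  · intro a b; simpa using hτ.map_mul_comm _ _
  · intro a b; simpa using hσ.map_mul_comm _ _

variable {V : Type u} {G : SimpleGraph V}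

/-- Some generator anticommutes with the word, so conjugation by it negates the word while
preserving the trace. -/
theorem IsNondegenerate.trace_wordProd (hG : IsNondegenerate G) {τ : B G →ₗ[ℂ] ℂ}
    (hτ : IsTrace τ) {l : List V} (hl : content l ≠ 0) : τ (wordProd (B.gen G) l) = 0 := by
  have h := B.satisfiesRelations_gen G
  obtain ⟨v, hv⟩ := hG _ hl
  have h1 := h.mul_wordProd v l
  rw [hv, sgn_one, neg_one_smul] at h1
  have h2 := hτ.map_mul_comm (B.gen G v) (B.gen G v * wordProd (B.gen G) l)
  rw [← mul_assoc, h.mul_self, one_mul, h1, neg_mul, mul_assoc, h.mul_self, mul_one, map_neg] at h2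
  linear_combination h2 / 2

theorem IsNondegenerate.trace_eq (hG : IsNondegenerate G) {τ : B G →ₗ[ℂ] ℂ} (hτ : IsTrace τ) :
    τ = canonicalTrace G := by
  refine B.eq_of_words hτ.continuous (continuous_canonicalTrace G) fun l => ?_
  by_cases hl : content l = 0
  · obtain ⟨c, hc⟩ := (B.satisfiesRelations_gen G).wordProd_of_content_eq_zero hl
    rw [hc, map_smul, map_smul, hτ.map_one, canonicalTrace_one]
  · rw [hG.trace_wordProd hτ hl, canonicalTrace_wordProd G hl]

theorem B.mul_comm_of_gen {z : B G} (hz : ∀ x, B.gen G x * z = z * B.gen G x) (a : B G) :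
    a * z = z * a := by
  refine LinearMap.congr_fun (B.eq_of_words (f := LinearMap.mulRight ℂ z)
    (g := LinearMap.mulLeft ℂ z) (continuous_mul_const z) (continuous_const_mul z) fun l => ?_) a
  rw [LinearMap.mulRight_apply, LinearMap.mulLeft_apply]
  induction l with
  | nil => simp
  | cons x l ih => rw [wordProd_cons, mul_assoc, ih, ← mul_assoc, hz, mul_assoc]

/-- A content in the radical gives a word commuting with all generators. -/
theorem exists_central_of_not_isNondegenerate (hG : ¬ IsNondegenerate G) : ∃ z : B G,
    star z = z ∧ z * z = 1 ∧ (∀ a, a * z = z * a) ∧ canonicalTrace G z = 0 := by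
  have h := B.satisfiesRelations_gen G
  simp only [IsNondegenerate, not_forall, not_exists] at hG
  obtain ⟨s, hs, hv⟩ := hG
  set w := wordProd (B.gen G) (wordOf s) with hw
  have hτ : canonicalTrace G w = 0 := canonicalTrace_wordProd G (by rwa [content_wordOf])
  have hcomm : ∀ a, a * w = w * a := B.mul_comm_of_gen fun x => by
    rw [h.mul_wordProd, content_wordOf, (ZMod.two_cases _).resolve_right (hv x), sgn_zero,
      one_smul]
  have hstar : star w * w = 1 := h.star_wordProd_mul_self _
  obtain ⟨c, hc⟩ := h.wordProd_of_content_eq_zero (l := wordOf s ++ wordOf s)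
    (by rw [content_append, finsupp_add_self])
  rw [wordProd_append, ← hw] at hc
  have hsw : star w = sgn c • w :=
    calc star w = sgn c • (star w * (w * w)) := by
          rw [hc, mul_smul_comm, mul_one, smul_smul, sgn_mul_self, one_smul]
      _ = _ := by rw [← mul_assoc, hstar, one_mul]
  -- The central word squares to plus or minus one; in the latter case multiplication by `Complex.I`
  -- makes it self-adjoint with square one.
  rcases ZMod.two_cases c with rfl | rfl
  · exact ⟨w, by simpa using hsw, by simpa using hc, hcomm, hτ⟩
  · refine ⟨Complex.I • w, ?_, ?_, fun a => ?_, ?_⟩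
    · rw [star_smul, hsw]; simp
    · rw [smul_mul_smul_comm, hc]; simp
    · rw [mul_smul_comm, hcomm, smul_mul_assoc]
    · rw [map_smul, hτ, smul_zero]

theorem isNondegenerate_of_trace_unique
    (huniq : ∀ τ : B G →ₗ[ℂ] ℂ, IsTrace τ → τ = canonicalTrace G) : IsNondegenerate G := by
  by_contra hG
  obtain ⟨z, hsz, hzz, hcomm, hz⟩ := exists_central_of_not_isNondegenerate hG
  have hτ := isTrace_canonicalTrace G
  -- This is twice a central projection. Weighting the canonical trace by `p` keeps it positive,
  -- tracial and normalized, the last because `z` has trace zero.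
  set p := 1 + z with hp
  have hpc (a : B G) : a * p = p * a := by rw [hp, mul_add, add_mul, hcomm, mul_one, one_mul]
  have hpp : p * p = (2 : ℂ) • p := by
    rw [hp, mul_add, add_mul, add_mul, hzz, two_smul]
    simp only [mul_one, one_mul]
    abel
  have hps : star p = p := by rw [hp, star_add, star_one, hsz]
  have hpos (a : B G) : p * (star a * a) = (1 / 2 : ℂ) • (star (a * p) * (a * p)) := by
    have : star (a * p) * (a * p) = (2 : ℂ) • (p * (star a * a)) :=
      calc star (a * p) * (a * p) = p * (star a * a) * p := by
            rw [star_mul, hps]; simp only [mul_assoc]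
        _ = _ := by rw [hpc, ← mul_assoc, hpp, smul_mul_assoc]
    rw [this, smul_smul]
    norm_num
  have htr : IsTrace ((canonicalTrace G).comp (LinearMap.mulLeft ℂ p)) :=
    { nonneg := fun a => by
        rw [LinearMap.comp_apply, LinearMap.mulLeft_apply, hpos, map_smul,
          canonicalTrace_star_mul_self, smul_eq_mul]
        have : (1 / 2 : ℂ) = ((1 / 2 : ℝ) : ℂ) := by norm_num
        rw [this, ← Complex.ofReal_mul, Complex.ofReal_re, Complex.ofReal_im]
        exact ⟨by positivity, rfl⟩
      map_one := by
        rw [LinearMap.comp_apply, LinearMap.mulLeft_apply, mul_one, hp, map_add, hz, hτ.map_one,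
          add_zero]
      map_mul_comm := fun a b => by
        simp only [LinearMap.comp_apply, LinearMap.mulLeft_apply]
        rw [← mul_assoc, hτ.map_mul_comm, ← mul_assoc, hpc, mul_assoc] }
  -- The two traces differ at `z`: the weighted one takes the value one there, the canonical one
  -- zero.
  have h1 := LinearMap.congr_fun (huniq _ htr) z
  rw [LinearMap.comp_apply, LinearMap.mulLeft_apply, hz, hp, add_mul, one_mul, hzz, map_add, hz,
    hτ.map_one, zero_add] at h1
  exact one_ne_zero h1

end Traces

/-! ### Simplicity -/

section Simplicity

variable {V : Type u} {G : SimpleGraph V}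

/-- Contractions of `B(G)` preserving ideals and the unit, and acting diagonally on words. -/
structure IsAveraging (Φ : B G →ₗ[ℂ] B G) : Prop where
  norm_le : ∀ a, ‖Φ a‖ ≤ ‖a‖
  mem : ∀ (J : TwoSidedIdeal (B G)) a, a ∈ J → Φ a ∈ J
  map_one : Φ 1 = 1
  diag : ∀ l, ∃ c : ℂ, Φ (wordProd (B.gen G) l) = c • wordProd (B.gen G) l

theorem IsAveraging.id : IsAveraging (LinearMap.id : B G →ₗ[ℂ] B G) :=
  ⟨fun _ => le_rfl, fun _ _ h => h, rfl, fun _ => ⟨1, (one_smul _ _).symm⟩⟩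

theorem IsAveraging.comp {Φ Ψ : B G →ₗ[ℂ] B G} (hΦ : IsAveraging Φ) (hΨ : IsAveraging Ψ) :
    IsAveraging (Φ.comp Ψ) where
  norm_le a := (hΦ.norm_le _).trans (hΨ.norm_le a)
  mem J a h := hΦ.mem J _ (hΨ.mem J a h)
  map_one := by rw [LinearMap.comp_apply, hΨ.map_one, hΦ.map_one]
  diag l := by
    obtain ⟨c, hc⟩ := hΨ.diag l
    obtain ⟨d, hd⟩ := hΦ.diag l
    exact ⟨c * d, by rw [LinearMap.comp_apply, hc, map_smul, hd, smul_smul]⟩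

/-- The average of the identity and conjugation by a generator. -/
def conjAverage (G : SimpleGraph V) (v : V) : B G →ₗ[ℂ] B G :=
  (1 / 2 : ℂ) • (LinearMap.id +
    (LinearMap.mulLeft ℂ (B.gen G v)).comp (LinearMap.mulRight ℂ (B.gen G v)))

theorem conjAverage_apply (v : V) (a : B G) :
    conjAverage G v a = (1 / 2 : ℂ) • (a + B.gen G v * (a * B.gen G v)) := rfl

theorem conjAverage_wordProd (v : V) (l : List V) : conjAverage G v (wordProd (B.gen G) l) =
    ((1 / 2 : ℂ) * (1 + sgn (adjForm G v (content l)))) • wordProd (B.gen G) l := by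
  have h := B.satisfiesRelations_gen G
  rw [conjAverage_apply, ← mul_assoc, h.mul_wordProd, smul_mul_assoc, mul_assoc, h.mul_self,
    mul_one, mul_smul, add_smul, one_smul]

theorem TwoSidedIdeal.smul_mem_of_mem (J : TwoSidedIdeal (B G)) (c : ℂ) {a : B G} (ha : a ∈ J) :
    c • a ∈ J := by
  rw [← one_mul a, ← smul_mul_assoc]
  exact J.mul_mem_left _ _ ha

theorem isAveraging_conjAverage (v : V) : IsAveraging (conjAverage G v) where
  norm_le a := by
    have h := (B.satisfiesRelations_gen G).unitary v
    rw [conjAverage_apply, norm_smul]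
    have : ‖a + B.gen G v * (a * B.gen G v)‖ ≤ ‖a‖ + ‖a‖ := by
      refine (norm_add_le _ _).trans (add_le_add_right (le_of_eq ?_) _)
      rw [CStarRing.norm_mem_unitary_mul _ h, CStarRing.norm_mul_mem_unitary _ h]
    norm_num
    linarith
  mem J a h := TwoSidedIdeal.smul_mem_of_mem J _
    (J.add_mem h (J.mul_mem_left _ _ (J.mul_mem_right _ _ h)))
  map_one := by
    rw [conjAverage_apply, one_mul, (B.satisfiesRelations_gen G).mul_self, ← two_smul ℂ, smul_smul]
    norm_num
  diag l := ⟨_, conjAverage_wordProd v l⟩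

/-- Allowing a prior averaging `Φ` makes the induction pass through sums: once one summand has
become a scalar, the averaging needed for the other leaves it fixed. -/
theorem IsNondegenerate.exists_isAveraging (hG : IsNondegenerate G) (f : FreeStarAlgebra V)
    {Φ : B G →ₗ[ℂ] B G} (hΦ : IsAveraging Φ) : ∃ Ψ : B G →ₗ[ℂ] B G, IsAveraging Ψ ∧
      Ψ (Φ (B.ofFree G f)) = canonicalTrace G (B.ofFree G f) • 1 := by
  induction f using FreeStarAlgebra.induction_linear generalizing Φ with
  | zero => exact ⟨_, .id, by simp⟩
  | add f g hf hg =>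
    obtain ⟨Ψ, hΨ, h1⟩ := hf hΦ
    obtain ⟨Ψ', hΨ', h2⟩ := hg (hΨ.comp hΦ)
    refine ⟨Ψ'.comp Ψ, hΨ'.comp hΨ, ?_⟩
    rw [LinearMap.comp_apply] at h2 ⊢
    rw [map_add, map_add, map_add, map_add, map_add, h1, h2, map_smul, hΨ'.map_one, add_smul]
  | mono m c =>
    rw [B.ofFree_mono]
    by_cases hm : content m.toList = 0
    · obtain ⟨d, hd⟩ := (B.satisfiesRelations_gen G).wordProd_of_content_eq_zero hm
      refine ⟨_, .id, ?_⟩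
      rw [hd, LinearMap.id_apply]
      simp only [map_smul, hΦ.map_one, canonicalTrace_one, smul_smul, smul_eq_mul, mul_one]
    · obtain ⟨v, hv⟩ := hG _ hm
      refine ⟨_, isAveraging_conjAverage v, ?_⟩
      obtain ⟨d, hd⟩ := hΦ.diag m.toList
      rw [map_smul, hd, map_smul, map_smul, map_smul, conjAverage_wordProd, hv,
        canonicalTrace_wordProd G hm]
      simp

theorem IsNondegenerate.isSimple (hG : IsNondegenerate G) : IsSimpleCStarAlgebra (B G) := by
  refine ⟨inferInstance, fun J hJ => or_iff_not_imp_right.mpr fun htop => ?_⟩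
  have hmem {a : B G} (ha : a ∈ J) : canonicalTrace G a • (1 : B G) ∈ J := by
    change _ ∈ (J : Set (B G))
    rw [← hJ.closure_eq, Metric.mem_closure_iff]
    intro ε hε
    -- Averaging turns the approximant into its trace times the unit. Both the trace and the
    -- averaging are contractions, so each costs at most half of `ε`.
    obtain ⟨f, hf⟩ := (B.denseRange_ofFree G).exists_dist_lt a (half_pos hε)
    obtain ⟨Ψ, hΨ, h⟩ := hG.exists_isAveraging f .id
    rw [LinearMap.id_apply] at h
    refine ⟨Ψ a, hΨ.mem J a ha, ?_⟩
    have h1 : ‖canonicalTrace G (a - B.ofFree G f) • (1 : B G)‖ ≤ ‖a - B.ofFree G f‖ := by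
      rw [norm_smul, norm_one, mul_one]
      exact norm_canonicalTrace_le G _
    have h2 := hΨ.norm_le (a - B.ofFree G f)
    rw [dist_eq_norm] at hf
    calc dist (canonicalTrace G a • (1 : B G)) (Ψ a)
        = ‖canonicalTrace G (a - B.ofFree G f) • (1 : B G) - Ψ (a - B.ofFree G f)‖ := by
          rw [dist_eq_norm, map_sub, map_sub, h, sub_smul, sub_sub_sub_cancel_right]
      _ ≤ _ := norm_sub_le _ _
      _ < ε := by linarith
  have hzero {a : B G} (ha : a ∈ J) : canonicalTrace G a = 0 := by
    by_contra hne
    refine htop (TwoSidedIdeal.one_mem_iff J |>.mp ?_)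
    have := TwoSidedIdeal.smul_mem_of_mem J (canonicalTrace G a)⁻¹ (hmem ha)
    rwa [smul_smul, inv_mul_cancel₀ hne, one_smul] at this
  refine le_antisymm (fun a ha => ?_) bot_le
  -- With `a`, the ideal contains `star a * a`, whose trace vanishes; faithfulness gives `a = 0`.
  exact (TwoSidedIdeal.mem_bot _).mpr (canonicalTrace_faithful G (hzero (J.mul_mem_left _ _ ha)))

end Simplicity

/-! ### Parities of adjacencies -/

section Parity

variable {V : Type u}

open Classical in
/-- The number modulo `2` of vertices in `s` adjacent to `v`. -/
def adjParity (G : SimpleGraph V) (v : V) (s : Finset V) : ZMod 2 :=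
  ∑ u ∈ s, if G.Adj v u then 1 else 0

theorem adjForm_eq_adjParity (G : SimpleGraph V) (v : V) (s : V →₀ ZMod 2) :
    adjForm G v s = adjParity G v s.support := by
  rw [adjForm, Finsupp.liftAddHom_apply, Finsupp.sum, adjParity]
  refine Finset.sum_congr rfl fun u hu => ?_
  rw [(ZMod.two_cases (s u)).resolve_left (Finsupp.mem_support_iff.mp hu)]
  split_ifs <;> rfl

theorem odd_ncard_iff (G : SimpleGraph V) (v : V) (s : Finset V) :
    Odd {u : V | u ∈ s ∧ G.Adj u v}.ncard ↔ adjParity G v s = 1 := by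
  classical
  have : {u : V | u ∈ s ∧ G.Adj u v} = (s.filter fun u => G.Adj v u : Finset V) := by
    ext u; simp [G.adj_comm]
  rw [this, Set.ncard_coe_finset, adjParity, Finset.sum_boole, ZMod.natCast_eq_one_iff_odd]

open Classical in
theorem sum_adjParity_comm (G : SimpleGraph V) (s t : Finset V) :
    ∑ v ∈ s, adjParity G v t = ∑ v ∈ t, adjParity G v s := by
  simp only [adjParity]
  rw [Finset.sum_comm]
  exact Finset.sum_congr rfl fun u _ => Finset.sum_congr rfl fun v _ =>
    if_congr (G.adj_comm v u) rfl rfl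

theorem adjParity_induce (G : SimpleGraph V) (T : Set V) (v : T) (s : Finset T) :
    adjParity (G.induce T) v s = adjParity G v (s.map (Function.Embedding.subtype _)) := by
  rw [adjParity, adjParity, Finset.sum_map]
  rfl

theorem isNondegenerate_iff (G : SimpleGraph V) :
    IsNondegenerate G ↔ ∀ s : Finset V, s.Nonempty → ∃ v, adjParity G v s = 1 := by
  classical
  constructor
  · intro h s hs
    let t : V →₀ ZMod 2 := Finsupp.indicator s fun _ _ => 1
    have ht : t.support = s := by
      ext u; simp [t]
    obtain ⟨v, hv⟩ := h t (by rwa [← Finsupp.support_nonempty_iff, ht])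
    exact ⟨v, by rwa [adjForm_eq_adjParity, ht] at hv⟩
  · intro h s hs
    obtain ⟨v, hv⟩ := h s.support (Finsupp.support_nonempty_iff.mpr hs)
    exact ⟨v, by rwa [adjForm_eq_adjParity]⟩

open Classical in
/-- The subsets of `T` to which every vertex of `T` is adjacent an even number of times. -/
def radical (G : SimpleGraph V) (T : Finset V) : Finset (Finset V) :=
  T.powerset.filter fun s => ∀ v ∈ T, adjParity G v s = 0

theorem mem_radical {G : SimpleGraph V} {T s : Finset V} :
    s ∈ radical G T ↔ s ⊆ T ∧ ∀ v ∈ T, adjParity G v s = 0 := by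
  rw [radical, Finset.mem_filter, Finset.mem_powerset]

-- The set `s` leaves the radical because `v` sees it oddly. Symmetry of the form prevents any set
-- containing `v` from entering.
open Classical in
theorem radical_insert_ssubset {G : SimpleGraph V} {T s : Finset V} (hs : s ∈ radical G T)
    {v : V} (hv : adjParity G v s = 1) : radical G (insert v T) ⊂ radical G T := by
  obtain ⟨hsT, hs0⟩ := mem_radical.mp hs
  refine (Finset.ssubset_iff_of_subset fun t ht => ?_).mpr ⟨s, hs, fun h => ?_⟩
  · obtain ⟨htT, ht0⟩ := mem_radical.mp ht
    refine mem_radical.mpr ⟨?_, fun x hx => ht0 x (Finset.mem_insert_of_mem hx)⟩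
    have hvt : v ∉ t := by
      intro hvt
      -- The pairing of `t` with `s` is one when summed over `t`, where only `v` contributes, but
      -- zero when summed over `s`, since `t` is in the new radical.
      have h1 : ∑ x ∈ t, adjParity G x s = 1 := by
        rw [Finset.sum_eq_single_of_mem v hvt, hv]
        intro x hx hxv
        exact hs0 x ((Finset.mem_insert.mp (htT hx)).resolve_left hxv)
      rw [sum_adjParity_comm, Finset.sum_eq_zero fun x hx =>
        ht0 x (Finset.mem_insert_of_mem (hsT hx))] at h1
      exact zero_ne_one h1
    exact (Finset.subset_insert_iff_of_notMem hvt).mp htT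
  · rw [(mem_radical.mp h).2 v (Finset.mem_insert_self v T)] at hv
    exact zero_ne_one hv

theorem isNondegenerate_induce_of_radical {G : SimpleGraph V} {T : Finset V}
    (h : ∀ s ∈ radical G T, s = ∅) : IsNondegenerate (G.induce (T : Set V)) := by
  rw [isNondegenerate_iff]
  intro s hs
  by_contra! hv
  have : s.map (Function.Embedding.subtype _) = ∅ := by
    refine h _ (mem_radical.mpr ⟨fun x hx => ?_, fun v hvT => ?_⟩)
    · obtain ⟨y, -, rfl⟩ := Finset.mem_map.mp hx
      exact y.2
    · have := adjParity_induce G (T : Set V) ⟨v, hvT⟩ s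
      rw [← this]
      exact (ZMod.two_cases _).resolve_right (hv _)
  exact hs.ne_empty (Finset.map_eq_empty.mp this)

/-- As long as the radical of the restricted form contains a nonempty set, adjoining a vertex that
sees this set oddly shrinks the radical, which is finite. -/
theorem IsNondegenerate.exists_finset {G : SimpleGraph V} (hG : IsNondegenerate G)
    (S : Finset V) : ∃ T : Finset V, S ⊆ T ∧ IsNondegenerate (G.induce (T : Set V)) := by
  classical
  induction hn : (radical G S).card using Nat.strong_induction_on generalizing S with
  | _ n ih =>
    by_cases h : ∀ s ∈ radical G S, s = ∅
    · exact ⟨S, subset_rfl, isNondegenerate_induce_of_radical h⟩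
    · push Not at h
      obtain ⟨s, hs, hne⟩ := h
      obtain ⟨v, hv⟩ := (isNondegenerate_iff G).mp hG s hne
      obtain ⟨T, hT, hnd⟩ := ih _
        (by rw [← hn]; exact Finset.card_lt_card (radical_insert_ssubset hs hv)) (insert v S) rfl
      exact ⟨T, (Finset.subset_insert v S).trans hT, hnd⟩

end Parity

/-! ### Finite nondegenerate graphs give full matrix algebras -/

section FiniteGraph

variable {V : Type u} [Finite V] {G : SimpleGraph V}

theorem IsSimpleCStarAlgebra.isSimpleRing {A : Type v} [CStarAlgebra A] [FiniteDimensional ℂ A]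
    (hA : IsSimpleCStarAlgebra A) : IsSimpleRing A := by
  have := hA.1
  refine .of_eq_bot_or_eq_top fun J => hA.2 J ?_
  exact Submodule.closed_of_finiteDimensional ((TwoSidedIdeal.asIdeal J).restrictScalars ℂ)

open scoped ComplexOrder MatrixOrder Matrix.Norms.L2Operator in
/-- A representation of the generators by matrices becomes unitary after a change of basis. -/
theorem exists_unitarizing {n : ℕ} (φ : B G →ₐ[ℂ] Matrix (Fin n) (Fin n) ℂ) :
    ∃ q : (Matrix (Fin n) (Fin n) ℂ)ˣ, ∀ x,
      star (q.val * φ (B.gen G x) * q⁻¹.val) =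
      q.val * φ (B.gen G x) * q⁻¹.val := by
  have := finite_contents V
  have := Fintype.ofFinite (V →₀ ZMod 2)
  have h := B.satisfiesRelations_gen G
  let w (s : V →₀ ZMod 2) : Matrix (Fin n) (Fin n) ℂ := φ (wordProd (B.gen G) (wordOf s))
  have hunit (s : V →₀ ZMod 2) : IsUnit (w s) :=
    IsUnit.map φ ⟨⟨_, _, h.wordProd_mul_star_self _, h.star_wordProd_mul_self _⟩, rfl⟩
  -- This averages the inner product over the finite group of signed words; the signs cancel in each
  -- term, so one word per content suffices.
  have hpos : (∑ s, star (w s) * w s).PosDef := by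
    refine Matrix.posDef_sum ⟨0, Finset.mem_univ _⟩ fun s _ => ?_
    exact Matrix.isStrictlyPositive_iff_posDef.mp
      (CStarAlgebra.isStrictlyPositive_iff_eq_star_mul_self.mpr ⟨w s, hunit s, rfl⟩)
  obtain ⟨q, hq, hqp⟩ := CStarAlgebra.isStrictlyPositive_iff_eq_star_mul_self.mp
    hpos.isStrictlyPositive
  lift q to (Matrix (Fin n) (Fin n) ℂ)ˣ using hq
  refine ⟨q, fun x => ?_⟩
  set g := φ (B.gen G x) with hg
  have hgg : g * g = 1 := by rw [hg, ← map_mul, h.mul_self, map_one]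
  -- Right multiplication by a generator permutes the representatives up to sign, so the averaged
  -- form is invariant. In a basis orthonormal for it the generators are unitary and, having square
  -- one, self-adjoint.
  have hterm (s : V →₀ ZMod 2) : star g * (star (w s) * w s) * g =
      star (w (s + Finsupp.single x 1)) * w (s + Finsupp.single x 1) := by
    obtain ⟨c, hc⟩ := h.wordProd_of_content_eq (l := wordOf s ++ [x])
      (m := wordOf (s + Finsupp.single x 1)) (by simp)
    have hw : w s * g = sgn c • w (s + Finsupp.single x 1) := by
      rw [hg, ← map_mul, ← map_smul, ← hc]; simp
    calc star g * (star (w s) * w s) * g = star (w s * g) * (w s * g) := by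
          rw [star_mul]; simp only [mul_assoc]
      _ = _ := by
          rw [hw, star_smul, smul_mul_smul_comm]
          rcases ZMod.two_cases c with rfl | rfl <;> simp
  have hinv : star g * (star q.val * q.val) * g = star q.val * q.val := by
    rw [← hqp, Finset.mul_sum, Finset.sum_mul, Finset.sum_congr rfl fun s _ => hterm s]
    exact Equiv.sum_comp (Equiv.addRight (Finsupp.single x (1 : ZMod 2)))
      fun s => star (w s) * w s
  have hinv' : star g * star q.val * q.val = star q.val * q.val * g := by
    calc star g * star q.val * q.val = star g * (star q.val * q.val) * g * g := by
          rw [mul_assoc _ g g, hgg, mul_one, mul_assoc]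
      _ = _ := by rw [hinv]
  have hqs : star q⁻¹.val * star q.val = 1 := by
    rw [← star_mul, Units.mul_inv, star_one]
  calc star (q.val * g * q⁻¹.val)
      = star q⁻¹.val * (star g * star q.val * q.val) * q⁻¹.val := by
        rw [star_mul, star_mul]
        simp only [mul_assoc, Units.mul_inv, mul_one]
    _ = star q⁻¹.val * star q.val * (q.val * g * q⁻¹.val) := by
        rw [hinv']; simp only [mul_assoc]
    _ = _ := by rw [hqs, one_mul]

/-- An algebra homomorphism on the algebra of a finite graph preserving the adjoints of the
generators preserves all adjoints. -/
theorem B.map_star_of_gen {R : Type v} [Ring R] [StarRing R] [Algebra ℂ R] [StarModule ℂ R]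
    (φ : B G →ₐ[ℂ] R) (hφ : ∀ x, star (φ (B.gen G x)) = φ (B.gen G x)) (a : B G) :
    φ (star a) = star (φ a) := by
  have h := B.satisfiesRelations_gen G
  have hword (l : List V) :
      φ (star (wordProd (B.gen G) l)) = star (φ (wordProd (B.gen G) l)) := by
    induction l with
    | nil => simp
    | cons x l ih =>
      rw [wordProd_cons, star_mul, map_mul, ih, h.star_eq, map_mul, star_mul, hφ]
  have ha : a ∈ Submodule.span ℂ (Set.range (wordProd (B.gen G))) := by
    rw [B.span_words_eq_top]; trivial
  induction ha using Submodule.span_induction with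
  | mem x hx => obtain ⟨l, rfl⟩ := hx; exact hword l
  | zero => simp
  | add x y _ _ hx hy => rw [star_add, map_add, hx, hy, map_add, star_add]
  | smul c x _ hx => rw [star_smul, map_smul, hx, map_smul, star_smul]

/-- Wedderburn's theorem over the complex numbers yields only an algebra isomorphism; conjugation by
the matrix from `exists_unitarizing` makes it preserve adjoints. -/
theorem IsNondegenerate.isFullMatrixAlgebra (hG : IsNondegenerate G) :
    IsFullMatrixAlgebra (B G) := by
  have := hG.isSimple.isSimpleRing
  obtain ⟨n, hn, ⟨φ⟩⟩ := IsSimpleRing.exists_algEquiv_matrix_of_isAlgClosed ℂ (B G)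
  obtain ⟨q, hq⟩ := exists_unitarizing (φ : B G →ₐ[ℂ] Matrix (Fin n) (Fin n) ℂ)
  let ψ : B G ≃ₐ[ℂ] Matrix (Fin n) (Fin n) ℂ :=
    φ.trans (MulSemiringAction.toAlgEquiv ℂ (Matrix (Fin n) (Fin n) ℂ) (ConjAct.toConjAct q))
  refine ⟨n, NeZero.one_le, ⟨StarAlgEquiv.ofAlgEquiv ψ fun a => ?_⟩⟩
  exact B.map_star_of_gen (ψ : B G →ₐ[ℂ] Matrix (Fin n) (Fin n) ℂ) hq a

end FiniteGraph

/-! ### Direct limits -/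

section DirectLimit

variable {V : Type u} (G : SimpleGraph V)

theorem isAM_of_cofinal (h : ∀ S : Finset V, ∃ T : Finset V, S ⊆ T ∧
    IsFullMatrixAlgebra (B (G.induce (T : Set V)))) : IsAM (B G) := by
  classical
  let I := {T : Finset V // IsFullMatrixAlgebra (B (G.induce (T : Set V)))}
  have hdir : IsDirectedOrder I := ⟨fun S T => by
    obtain ⟨U, hU, hM⟩ := h (S.1 ∪ T.1)
    exact ⟨⟨U, hM⟩, Finset.subset_union_left.trans hU, Finset.subset_union_right.trans hU⟩⟩
  have hne : Nonempty I := by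
    obtain ⟨T, -, hT⟩ := h ∅
    exact ⟨⟨T, hT⟩⟩
  refine ⟨I, inferInstance, hdir, hne, fun T => B (G.induce (T.1 : Set V)), fun T => inferInstance,
    fun S T hST => inclusionMap G (Finset.coe_subset.mpr hST), fun T => inducedMap G T.1,
    fun T => T.2, ?_⟩
  refine ⟨fun T a => ?_, fun S T U hST hTU a => ?_, fun S T hST a => ?_, ?_, fun S a => ?_⟩
  · refine DFunLike.congr_fun (g := StarAlgHom.id ℂ _) (B.hom_ext fun x => ?_) a
    rw [inclusionMap_gen]
    rfl
  · refine DFunLike.congr_fun (f := (inclusionMap G _).comp (inclusionMap G _))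
      (B.hom_ext fun x => ?_) a
    rw [StarAlgHom.comp_apply, inclusionMap_gen, inclusionMap_gen, inclusionMap_gen]
  · exact inducedMap_inclusionMap G _ a
  · refine (B.denseRange_ofFree G).mono ?_
    rintro _ ⟨f, rfl⟩
    obtain ⟨T, hT⟩ := exists_finset_range_inducedMap G f
    obtain ⟨U, hU, hM⟩ := h T
    exact Set.mem_iUnion.mpr ⟨⟨U, hM⟩, hT U (Finset.coe_subset.mpr hU)⟩
  -- The maps into `B G` are isometric, so the norms along the system are constant.
  · refine tendsto_const_nhds.congr fun T => ?_
    rw [← inducedMap_inclusionMap G (Finset.coe_subset.mpr T.2), norm_inducedMap]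

end DirectLimit

end GraphCStar

end

theorem mainTheorem5 {V : Type*} [Infinite V] (G : SimpleGraph V) :
    List.TFAE [
      ∀ S : Finset V, ∃ T : Finset V, S ⊆ T ∧
        GraphCStar.IsFullMatrixAlgebra (GraphCStar.B (G.induce (T : Set V))),
      GraphCStar.IsAM (GraphCStar.B G),
      GraphCStar.IsSimpleCStarAlgebra (GraphCStar.B G) ∧
        ∃! τ : GraphCStar.B G →ₗ[ℂ] ℂ, GraphCStar.IsTrace τ,
      ∀ s : Finset V, s.Nonempty → ∃ v : V, Odd {u : V | u ∈ s ∧ G.Adj u v}.ncard] := by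
  have h4 : (∀ s : Finset V, s.Nonempty → ∃ v : V, Odd {u : V | u ∈ s ∧ G.Adj u v}.ncard) ↔
      GraphCStar.IsNondegenerate G := by
    rw [GraphCStar.isNondegenerate_iff]
    simp only [GraphCStar.odd_ncard_iff]
  have hτ := GraphCStar.isTrace_canonicalTrace G
  rw [h4]
  tfae_have 1 → 2 := GraphCStar.isAM_of_cofinal G
  tfae_have 2 → 4 := fun h =>
    GraphCStar.isNondegenerate_of_trace_unique fun τ h' => h.trace_unique h' hτ
  tfae_have 4 → 3 := fun h => ⟨h.isSimple, _, hτ, fun τ h' => h.trace_eq h'⟩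
  -- Uniqueness of the trace already suffices here; simplicity then comes back through condition 4.
  tfae_have 3 → 4 := fun h =>
    GraphCStar.isNondegenerate_of_trace_unique fun τ h' => h.2.unique h' hτ
  tfae_have 4 → 1 := fun h S => by
    obtain ⟨T, hST, hT⟩ := h.exists_finset S
    exact ⟨T, hST, hT.isFullMatrixAlgebra⟩
  tfae_finish
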